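/- Let $m\ge 2$ and let $H=\mathrm{SL}_m\mathbb R/\mathrm{SO}(m)$ with its invariant Riemannian metric. The visual sphere $\partial_\infty H$ is the set of asymptote classes of geodesic rays, identified, with its topology, with the unit sphere of the tangent space at a base point (symmetric traceless matrices $Z$ with $\|Z\|=1$, where $Z$ represents the ray $t\mapsto e^{tZ}\mathrm{SO}(m)$). A point $g\,\mathrm{SO}(m)\in H$ determines the inner product $\langle u,v\rangle=(g^{-1}u)\cdot(g^{-1}v)$ on $\mathbb R^m$. For a direct sum decomposition $\mathbb R^m=U_1\oplus\dots\oplus U_r$ the points of $H$ whose inner product makes the $U_i$ pairwise orthogonal form a totally geodesic copy of $\mathbb R^{r-1}\times\prod_i \mathrm{SL}(U_i)/\mathrm{SO}(U_i)$; let $S(U_1,\dots,U_r)\subset\partial_\infty H$ be its boundary sphere, i.e. the set of points at infinity represented by geodesic rays contained in it. Two subspheres $A,B\subset \partial_\infty H$ of complementary dimensions ($\dim A+\dim B=\dim\partial_\infty H-1$) are said to link if they are disjoint and $A$ cannot be contracted to a point in $\partial_\infty H\setminus B$. (For the spheres below this is equivalent to their linking number being non-zero, and it is symmetric in $A$ and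 $B$.) **Proposition.** Let $L_1,\dots,L_m,L$ be points of $\mathbb P^{m-1}=\mathbb P(\mathbb R^m)$ and let $P\subset\mathbb P^{m-1}$ be a hyperplane, in general position: any $m$ of the points $L_1,\dots,L_m,L$ span $\mathbb P^{m-1}$, and none of these $m+1$ points lies on $P$. Let $V_i$ be the hyperplane spanned by all the points $L_1,\dots,L_m$ except $L_i$. Then: 1. Each connected component of $\mathbb P^{m-1}\setminus(V_1\cup\dots\cup V_m)$ is an open $(m-1)$-simplex with vertices $L_1,\dots,L_m$, i.e. of the form $\{[c_1w_1+\dots+c_mw_m] : c_1,\dots,c_m>0\}$ for some non-zero vectors $w_i$ on the lines $L_i$. 2. Let $\sigma$ be the component that contains $L$. The spheres $S(L_1,\dots,L_m)$ and $S(L,P)$ are disjoint, and they link (equivalently in either order: the first is not contractible in the complement of the second; the second is not contractible in the complement of the first) if and only if $\sigma$ does not meet $P$. -/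

import Mathlib

open scoped LinearAlgebra.Projectivization

noncomputable section

namespace SLSymm

/-! ### The symmetric space `SL_m(ℝ) / SO(m)` -/

/-- `SO(m)` as a subgroup of `SL_m(ℝ)`. -/
def SO (m : ℕ) : Subgroup (Matrix.SpecialLinearGroup (Fin m) ℝ) where
  carrier := {k | (k : Matrix (Fin m) (Fin m) ℝ) * (k : Matrix (Fin m) (Fin m) ℝ).transpose = 1}
  one_mem' := by simp
  mul_mem' := by
    intro a b ha hb
    simp only [Set.mem_ofPred_eq, Matrix.SpecialLinearGroup.coe_mul, Matrix.transpose_mul] at *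
    rw [Matrix.mul_assoc, ← Matrix.mul_assoc (b : Matrix (Fin m) (Fin m) ℝ), hb, Matrix.one_mul, ha]
  inv_mem' := by
    intro a ha
    simp only [Set.mem_ofPred_eq] at *
    have h1 : (a : Matrix (Fin m) (Fin m) ℝ) *
        ((a⁻¹ : Matrix.SpecialLinearGroup (Fin m) ℝ) : Matrix (Fin m) (Fin m) ℝ) = 1 := by
      rw [← Matrix.SpecialLinearGroup.coe_mul, mul_inv_cancel]; simp
    have h2 : ((a⁻¹ : Matrix.SpecialLinearGroup (Fin m) ℝ) : Matrix (Fin m) (Fin m) ℝ) =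
        (a : Matrix (Fin m) (Fin m) ℝ).transpose :=
      (left_inv_eq_right_inv (mul_eq_one_comm.mp h1) ha)
    rw [h2, Matrix.transpose_transpose]
    exact mul_eq_one_comm.mp ha

/-- The symmetric space `SL_m(ℝ) / SO(m)`. -/
abbrev SymSpace (m : ℕ) : Type := Matrix.SpecialLinearGroup (Fin m) ℝ ⧸ SO m

/-- The positive definite symmetric matrix `g gᵀ` attached to the point `g SO(m)`. -/
def gram {m : ℕ} (p : SymSpace m) : Matrix (Fin m) (Fin m) ℝ :=
  Quotient.liftOn p
    (fun g => (g : Matrix (Fin m) (Fin m) ℝ) * (g : Matrix (Fin m) (Fin m) ℝ).transpose)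
    (by
      intro a b hab
      have h : a⁻¹ * b ∈ SO m := QuotientGroup.leftRel_apply.mp hab
      have hb : b = a * (a⁻¹ * b) := by group
      have h' : ((a⁻¹ * b : Matrix.SpecialLinearGroup (Fin m) ℝ) : Matrix (Fin m) (Fin m) ℝ) *
        ((a⁻¹ * b : Matrix.SpecialLinearGroup (Fin m) ℝ) :
          Matrix (Fin m) (Fin m) ℝ).transpose = 1 := h
      change _ = (b : Matrix (Fin m) (Fin m) ℝ) * (b : Matrix (Fin m) (Fin m) ℝ).transpose
      rw [hb, Matrix.SpecialLinearGroup.coe_mul a (a⁻¹ * b), Matrix.transpose_mul,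
        Matrix.mul_assoc, ← Matrix.mul_assoc _ _ (a : Matrix (Fin m) (Fin m) ℝ).transpose, h',
        Matrix.one_mul])

/-- The inner product on `ℝ^m` attached to a point of the symmetric space: at `g SO(m)` it is
`⟨u, v⟩ = (g⁻¹ u) ⬝ (g⁻¹ v) = uᵀ (g gᵀ)⁻¹ v`. -/
def innerAt {m : ℕ} (p : SymSpace m) (u v : Fin m → ℝ) : ℝ :=
  u ⬝ᵥ ((gram p)⁻¹.mulVec v)

/-- The `SL_m(ℝ)`-invariant Riemannian distance, normalised so that `t ↦ exp(tZ) SO(m)` has unit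
speed when `Z` is symmetric, traceless and of Frobenius norm one:
`d(p, q)² = ∑ (½ log λ)²` over the (positive) eigenvalues `λ` of `(gram p)⁻¹ (gram q)`, with
multiplicity.  Equivalently, `d(g SO(m), h SO(m))² = ∑ (log s)²` over the singular values `s` of
`g⁻¹ h`. -/
def sdist {m : ℕ} (p q : SymSpace m) : ℝ :=
  Real.sqrt ((((gram p)⁻¹ * gram q).charpoly.roots.map fun l => (Real.log l / 2) ^ 2).sum)

/-! ### Geodesic rays and the visual sphere -/

/-- The visual sphere of `SL_m(ℝ) / SO(m)`: the unit sphere, with its usual topology, in the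
tangent space at the base point `o = 1 · SO(m)`, that is, the symmetric traceless matrices of
Frobenius norm one.  The direction `Z` stands for the asymptote class of the geodesic ray
`t ↦ exp(tZ) · o`; every asymptote class contains exactly one ray issuing from `o`. -/
abbrev VisualSphere (m : ℕ) : Type :=
  {Z : Matrix (Fin m) (Fin m) ℝ // Z.IsSymm ∧ Z.trace = 0 ∧ ∑ i, ∑ j, Z i j ^ 2 = 1}

theorem det_exp_of_isSymm {m : ℕ} (A : Matrix (Fin m) (Fin m) ℝ) (hA : A.IsSymm)
    (htr : A.trace = 0) : (NormedSpace.exp A).det = 1 := by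
  have hH : A.IsHermitian := by
    rw [Matrix.IsHermitian, Matrix.conjTranspose_eq_transpose_of_trivial]; exact hA
  have hsp := hH.spectral_theorem
  have hsum : ∑ i, hH.eigenvalues i = 0 := by
    have := hH.trace_eq_sum_eigenvalues
    rw [htr] at this
    simpa using this.symm
  rw [Unitary.conjStarAlgAut_apply] at hsp
  set U : Matrix (Fin m) (Fin m) ℝ := (hH.eigenvectorUnitary : Matrix (Fin m) (Fin m) ℝ) with hU
  have hUU : U * star U = 1 := Unitary.coe_mul_star_self hH.eigenvectorUnitary
  have hinv : U⁻¹ = star U := Matrix.inv_eq_right_inv hUU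
  have hu : IsUnit U := (Matrix.isUnit_iff_isUnit_det U).mpr (Matrix.isUnit_det_of_right_inverse hUU)
  rw [hsp, ← hinv, Matrix.exp_conj U _ hu, Matrix.det_conj hu, Matrix.exp_diagonal,
    Matrix.det_diagonal]
  have : ∀ i, NormedSpace.exp ((RCLike.ofReal : ℝ → ℝ) ∘ hH.eigenvalues) i =
      Real.exp (hH.eigenvalues i) := by
    intro i
    rw [Pi.coe_exp, Real.exp_eq_exp_ℝ]
    rfl
  rw [Finset.prod_congr rfl (fun i _ => this i), ← Real.exp_sum, hsum, Real.exp_zero]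

/-- `exp(tZ)` as an element of `SL_m(ℝ)`. -/
def expSL {m : ℕ} (Z : VisualSphere m) (t : ℝ) : Matrix.SpecialLinearGroup (Fin m) ℝ :=
  ⟨NormedSpace.exp (t • Z.1),
    det_exp_of_isSymm _ (by simp [Matrix.IsSymm, Z.2.1.eq]) (by simp [Z.2.2.1])⟩

/-- The unit speed geodesic `t ↦ g exp(tZ) SO(m)`; for `t ≥ 0` these are all the geodesic rays of
the symmetric space. -/
def geodesic {m : ℕ} (g : Matrix.SpecialLinearGroup (Fin m) ℝ) (Z : VisualSphere m) (t : ℝ) :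
    SymSpace m :=
  QuotientGroup.mk (g * expSL Z t)

/-- Two geodesic rays are asymptotic if they stay at bounded distance. -/
def Asymptotic {m : ℕ} (γ δ : ℝ → SymSpace m) : Prop :=
  ∃ C : ℝ, ∀ t : ℝ, 0 ≤ t → sdist (γ t) (δ t) ≤ C

/-- The boundary at infinity of a subset `Y` of the symmetric space: the points at infinity
represented by geodesic rays that lie in `Y`. -/
def boundaryAtInfinity {m : ℕ} (Y : Set (SymSpace m)) : Set (VisualSphere m) :=
  {ξ | ∃ (g : Matrix.SpecialLinearGroup (Fin m) ℝ) (Z : VisualSphere m),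
    (∀ t : ℝ, 0 ≤ t → geodesic g Z t ∈ Y) ∧ Asymptotic (geodesic g Z) (geodesic 1 ξ)}

/-- The totally geodesic symmetric subspace of a direct sum decomposition `ℝ^m = ⨁ U_i`: the points
whose inner product makes the summands pairwise orthogonal.  It is the orbit of any one of its
points under the subgroup of `SL_m(ℝ)` preserving every `U_i`, and is a copy of
`ℝ^(r-1) × ∏ SL(U_i)/SO(U_i)`. -/
def symSubspace {m : ℕ} {ι : Type} (U : ι → Submodule ℝ (Fin m → ℝ)) : Set (SymSpace m) :=
  {p | Pairwise fun i j => ∀ u ∈ U i, ∀ v ∈ U j, innerAt p u v = 0}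

/-- The sphere at infinity `S(U_1, …, U_r)` of a direct sum decomposition. -/
def sphereAtInfinity {m : ℕ} {ι : Type} (U : ι → Submodule ℝ (Fin m → ℝ)) :
    Set (VisualSphere m) :=
  boundaryAtInfinity (symSubspace U)

/-! ### Linking -/

/-- `A` can be contracted to a point inside `C`. -/
def ContractsIn {X : Type*} [TopologicalSpace X] (A C : Set X) : Prop :=
  ∃ h : A ⊆ C, ContinuousMap.Nullhomotopic
    (⟨Set.inclusion h, continuous_inclusion h⟩ : C(A, C))

/-- `A` links `B`: they are disjoint and `A` cannot be contracted to a point in the complement of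
`B`.  For a `p`-sphere `A` and an unknotted `q`-sphere `B` in a `(p+q+1)`-sphere the complement of
`B` has the homotopy type of a `p`-sphere, so this says that the linking number is not zero. -/
def Links {X : Type*} [TopologicalSpace X] (A B : Set X) : Prop :=
  Disjoint A B ∧ ¬ ContractsIn A Bᶜ

/-! ### Projective space -/

/-- The usual (quotient) topology of real projective space. -/
instance projTopology (m : ℕ) : TopologicalSpace (ℙ ℝ (Fin m → ℝ)) :=
  TopologicalSpace.coinduced (Projectivization.mk' ℝ (V := Fin m → ℝ)) inferInstance

/-- The set of points of the projective subspace given by a linear subspace. -/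
def projPoints {m : ℕ} (W : Submodule ℝ (Fin m → ℝ)) : Set (ℙ ℝ (Fin m → ℝ)) :=
  {x | x.submodule ≤ W}

/-- The projective subspace `V_i` spanned by all the points `L_j` except `L_i`. -/
def faceHyperplane {m : ℕ} (Ls : Fin m → ℙ ℝ (Fin m → ℝ)) (i : Fin m) :
    Submodule ℝ (Fin m → ℝ) :=
  ⨆ (j : Fin m) (_ : j ≠ i), (Ls j).submodule

/-- The complement in projective space of the union of the hyperplanes `V_i`. -/
def faceComplement {m : ℕ} (Ls : Fin m → ℙ ℝ (Fin m → ℝ)) : Set (ℙ ℝ (Fin m → ℝ)) :=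
  (⋃ i, projPoints (faceHyperplane Ls i))ᶜ

/-- `σ` is an open projective `(m-1)`-simplex with vertices `L_1, …, L_m`: for some linearly
independent vectors `w_i` on the lines `L_i`, it consists of the points
`[c_1 w_1 + ⋯ + c_m w_m]` with all `c_i > 0`. -/
def IsOpenSimplex {m : ℕ} (Ls : Fin m → ℙ ℝ (Fin m → ℝ)) (σ : Set (ℙ ℝ (Fin m → ℝ))) : Prop :=
  ∃ w : Fin m → (Fin m → ℝ), LinearIndependent ℝ w ∧ (∀ i, w i ∈ (Ls i).submodule) ∧
    σ = {x | ∃ c : Fin m → ℝ, (∀ i, 0 < c i) ∧ ∑ i, c i • w i ∈ x.submodule}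

/-- General position of the points `L_1, …, L_m`, the point `L` and the hyperplane `P`: any `m` of
the `m + 1` points span projective space, and none of the `m + 1` points lies on `P`. -/
structure GeneralPosition {m : ℕ} (Ls : Fin m → ℙ ℝ (Fin m → ℝ)) (L : ℙ ℝ (Fin m → ℝ))
    (P : Submodule ℝ (Fin m → ℝ)) : Prop where
  independent : Projectivization.Independent Ls
  notMem_face : ∀ i, L ∉ projPoints (faceHyperplane Ls i)
  vertex_notMem : ∀ i, Ls i ∉ projPoints P
  notMem : L ∉ projPoints P

end SLSymm

end

/-!
Everything is equivariant under `SL_m(ℝ)`, and a translation turns the lines `L_i` into the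
coordinate axes, and `L`, `P` into `ℝ l`, `φ^⊥` with `|φ i| = |l i|` for all `i`. Then
`S(L_1, …, L_m)` consists of the diagonal directions, on which `φᵀ ξ φ = lᵀ ξ l`. Comparing growth
rates along asymptotic rays shows that every `ξ` in `S(L, P)` satisfies `φᵀ ξ φ ≤ lᵀ ξ l`, with
equality only if `l` is an eigenvector of `ξ`, which is impossible for a diagonal direction. Hence
the spheres are disjoint, and if `φ ≠ ± l` the linear functional `φᵀ ξ φ - lᵀ ξ l` is not zero and
either sphere can be pushed along segments into an open half of the visual sphere that misses the
other. If `φ = ± l`, then `S(L, P)` is the set of all directions with eigenvector `l`; the two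
spheres are the unit spheres of the image and the kernel of a linear projection, and they link
because the identity of a sphere is not null-homotopic. Finally `φ = ± l` says that all products
`φ i * l i` have the same sign, which means that `φ` has no zero on the open simplex containing `L`.
-/

noncomputable section

namespace SLSymm

section NoRetraction

open MeasureTheory Metric Set
open scoped NNReal

variable {E : Type*} [NormedAddCommGroup E] [NormedSpace ℝ E]

theorem approximatesLinearOn_id_add {v : E → E} {s : Set E} {c : ℝ≥0}
    (hv : LipschitzOnWith c v s) :
    ApproximatesLinearOn (fun x => x + v x) (ContinuousLinearEquiv.refl ℝ E : E →L[ℝ] E) s c := by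
  rw [ApproximatesLinearOn.approximatesLinearOn_iff_lipschitzOnWith]
  convert hv
  ext x
  simp

theorem lt_nnnorm_refl_inv {c : ℝ≥0} (hc : c < 1) :
    Subsingleton E ∨ c < ‖((ContinuousLinearEquiv.refl ℝ E).symm : E →L[ℝ] E)‖₊⁻¹ := by
  rcases subsingleton_or_nontrivial E with hE | hE
  · exact Or.inl hE
  · have hnorm : ‖((ContinuousLinearEquiv.refl ℝ E).symm : E →L[ℝ] E)‖₊ = 1 :=
      ContinuousLinearMap.nnnorm_id
    exact Or.inr (by rwa [hnorm, inv_one])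

theorem injOn_id_add {v : E → E} {s : Set E} {c : ℝ≥0} (hv : LipschitzOnWith c v s) (hc : c < 1) :
    InjOn (fun x => x + v x) s :=
  (approximatesLinearOn_id_add hv).injOn (lt_nnnorm_refl_inv hc)

theorem isOpen_image_id_add [CompleteSpace E] {v : E → E} {s : Set E} {c : ℝ≥0}
    (hv : LipschitzOnWith c v s) (hc : c < 1) (hs : IsOpen s) :
    IsOpen ((fun x => x + v x) '' s) :=
  (approximatesLinearOn_id_add hv).open_image
    (ContinuousLinearEquiv.refl ℝ E).toNonlinearRightInverse hs (lt_nnnorm_refl_inv hc)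

theorem image_ball_eq_of_eqOn_sphere [ProperSpace E] {f : E → E} {R : ℝ}
    (hf : ContinuousOn f (closedBall 0 R)) (hopen : IsOpen (f '' ball 0 R))
    (hmaps : MapsTo f (ball 0 R) (ball 0 R)) (hid : ∀ x, ‖x‖ = R → f x = x) :
    f '' ball 0 R = ball 0 R := by
  rcases (ball (0 : E) R).eq_empty_or_nonempty with h | hne
  · rw [h, image_empty]
  refine hmaps.image_subset.antisymm ?_
  have hclosed : IsClosed (f '' closedBall 0 R) :=
    ((isCompact_closedBall 0 R).image_of_continuousOn hf).isClosed
  refine (convex_ball (0 : E) R).isPreconnected.subset_left_of_subset_union hopen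
    hclosed.isOpen_compl (disjoint_compl_right.mono_right
      (compl_subset_compl.mpr (image_mono ball_subset_closedBall))) (fun y hy => ?_) ?_
  · refine or_iff_not_imp_right.mpr fun hy' => ?_
    obtain ⟨x, hx, rfl⟩ := not_not.mp hy'
    rcases (mem_closedBall_zero_iff.mp hx).lt_or_eq with hlt | heq
    · exact ⟨x, mem_ball_zero_iff.mpr hlt, rfl⟩
    · rw [hid x heq, mem_ball_zero_iff, heq] at hy
      exact absurd hy (lt_irrefl R)
  · obtain ⟨x, hx⟩ := hne
    exact ⟨f x, hmaps hx, x, hx, rfl⟩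

section Determinant

variable [FiniteDimensional ℝ E]

theorem exists_polynomial_det_one_add_smul (A : E →L[ℝ] E) :
    ∃ p : Polynomial ℝ, p.natDegree ≤ Module.finrank ℝ E ∧
      ∀ t : ℝ, (1 + t • A).det = p.eval t := by
  let b := Module.finBasis ℝ E
  let M := LinearMap.toMatrix b b (A : E →ₗ[ℝ] E)
  refine ⟨_, (Polynomial.natDegree_det_X_add_C_le M 1).trans_eq (Fintype.card_fin _), fun t => ?_⟩
  have htoMatrix : LinearMap.toMatrix b b ((1 + t • A : E →L[ℝ] E) : E →ₗ[ℝ] E) = t • M + 1 := by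
    rw [ContinuousLinearMap.toLinearMap_add, ContinuousLinearMap.toLinearMap_smul, map_add,
      map_smul, ContinuousLinearMap.toLinearMap_one, LinearMap.toMatrix_one, add_comm]
  rw [ContinuousLinearMap.det, ← LinearMap.det_toMatrix b, htoMatrix,
    ← Polynomial.coe_evalRingHom, RingHom.map_det]
  congr 1
  ext i j
  by_cases hij : i = j <;> simp [hij] <;> ring

theorem exists_det_one_add_eq_sum {ε : ℝ} (hε : 0 < ε) :
    ∃ (s : Finset ℝ) (w : ℝ → ℝ), (∀ t ∈ s, t ∈ Ioo 0 ε) ∧ ∑ t ∈ s, w t = 1 ∧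
      ∀ A : E →L[ℝ] E, (1 + A).det = ∑ t ∈ s, w t * (1 + t • A).det := by
  obtain ⟨s, hs, hcard⟩ := (Ioo_infinite hε).exists_subset_card_eq (Module.finrank ℝ E + 1)
  have hinj : InjOn id (s : Set ℝ) := Function.injective_id.injOn
  refine ⟨s, fun t => (Lagrange.basis s id t).eval 1, hs, ?_, fun A => ?_⟩
  · have hsum := Lagrange.sum_basis hinj (Finset.card_pos.mp (by lia))
    rw [← Polynomial.eval_finsetSum, hsum, Polynomial.eval_one]
  · obtain ⟨p, hp, hpe⟩ := exists_polynomial_det_one_add_smul A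
    have hdeg : p.degree < s.card := by
      rw [hcard]
      exact (Polynomial.degree_le_of_natDegree_le hp).trans_lt
        (by exact_mod_cast Nat.lt_succ_self _)
    have heval := congrArg (Polynomial.eval 1) (Lagrange.eq_interpolate hinj hdeg)
    rw [Lagrange.interpolate_apply, Polynomial.eval_finsetSum] at heval
    rw [← one_smul ℝ A, hpe, heval]
    exact Finset.sum_congr rfl fun t _ => by simp [hpe, mul_comm]

theorem det_one_add_ne_zero {A : E →L[ℝ] E} (hA : ‖A‖ < 1) : (1 + A).det ≠ 0 := by
  have hunit : IsUnit (1 + A) := by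
    simpa using isUnit_one_sub_of_norm_lt_one (x := -A) (by rwa [norm_neg])
  exact ((hunit.map ContinuousLinearMap.toLinearMapRingHom).map LinearMap.det).ne_zero

theorem det_one_add_pos {A : E →L[ℝ] E} (hA : ‖A‖ < 1) : 0 < (1 + A).det := by
  have hcont : ContinuousOn (fun B : E →L[ℝ] E => (1 + B).det) (ball 0 1) :=
    (ContinuousLinearMap.continuous_det.comp (continuous_const.add continuous_id)).continuousOn
  have hone : (1 + (0 : E →L[ℝ] E)).det = 1 := by
    rw [add_zero]; exact LinearMap.det_id
  by_contra hneg
  obtain ⟨B, hB, hB0⟩ := (convex_ball (0 : E →L[ℝ] E) 1).isPreconnected.intermediate_value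
    (mem_ball_zero_iff.mpr hA) (mem_ball_self one_pos) hcont
    ⟨not_lt.mp hneg, hone.symm ▸ zero_le_one⟩
  exact det_one_add_ne_zero (mem_ball_zero_iff.mp hB) hB0

end Determinant

section Volume

variable [FiniteDimensional ℝ E] [MeasurableSpace E] [BorelSpace E]
  (ν : Measure E) [ν.IsAddHaarMeasure] {u : E → E} {R : ℝ}

theorem integral_det_one_add_smul_fderiv_eq_of_lt {K : ℝ≥0} {t : ℝ} (hu : ContDiff ℝ 1 u)
    (hK : LipschitzOnWith K u (closedBall 0 R)) (hmaps : ∀ x ∈ ball 0 R, ‖x + u x‖ ≤ R)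
    (hzero : ∀ x, ‖x‖ = R → u x = 0) (ht : t ∈ Ioo 0 1) (htK : t * K < 1) :
    ∫ x in ball (0 : E) R, (1 + t • fderiv ℝ u x).det ∂ν = ν.real (ball 0 R) := by
  have hc : ‖t‖₊ * K < 1 := by
    rw [← NNReal.coe_lt_coe]; simpa [abs_of_pos ht.1] using htK
  have hlip : LipschitzOnWith (‖t‖₊ * K) (fun x => t • u x) (ball 0 R) :=
    (lipschitzWith_smul t).comp_lipschitzOnWith (hK.mono ball_subset_closedBall)
  have himage : (fun x => x + t • u x) '' ball 0 R = ball 0 R := by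
    refine image_ball_eq_of_eqOn_sphere (by have := hu.continuous; fun_prop)
      (isOpen_image_id_add hlip hc isOpen_ball) (fun x hx => ?_) fun x hx => by simp [hzero x hx]
    have hconv : x + t • u x = (1 - t) • x + t • (x + u x) := by module
    rw [mem_ball_zero_iff, hconv]
    calc ‖(1 - t) • x + t • (x + u x)‖ ≤ (1 - t) * ‖x‖ + t * ‖x + u x‖ := by
          refine (norm_add_le _ _).trans_eq ?_
          rw [norm_smul_of_nonneg (sub_nonneg.mpr ht.2.le), norm_smul_of_nonneg ht.1.le]
      _ < R := by nlinarith [hmaps x hx, mem_ball_zero_iff.mp hx, ht.1, ht.2]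
  have hderiv : ∀ x ∈ ball (0 : E) R,
      HasFDerivWithinAt (fun x => x + t • u x) (1 + t • fderiv ℝ u x) (ball 0 R) x := fun x _ =>
    ((hasFDerivAt_id x).add
      ((hu.differentiable one_ne_zero x).hasFDerivAt.const_smul t)).hasFDerivWithinAt
  have hdet : ∀ x ∈ ball (0 : E) R, 0 < (1 + t • fderiv ℝ u x).det := fun x hx => by
    refine det_one_add_pos ?_
    have hle : ‖fderiv ℝ u x‖ ≤ K := norm_fderiv_le_of_lipschitzOn ℝ (isOpen_ball.mem_nhds hx)
      (hK.mono ball_subset_closedBall)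
    rw [norm_smul, Real.norm_of_nonneg ht.1.le]
    exact (mul_le_mul_of_nonneg_left hle ht.1.le).trans_lt htK
  have hchange := integral_image_eq_integral_abs_det_fderiv_smul ν measurableSet_ball hderiv
    (injOn_id_add hlip hc) fun _ => (1 : ℝ)
  rw [himage] at hchange
  simp only [smul_eq_mul, mul_one, integral_const, measureReal_restrict_apply_univ] at hchange
  rw [hchange]
  exact setIntegral_congr_fun measurableSet_ball fun x hx => (abs_of_pos (hdet x hx)).symm

/-- For small `t` the map `x + t (f x - x)` permutes the ball; both sides being polynomial in `t`,
the volume identity persists up to `t = 1`. -/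
theorem integral_det_fderiv_eq_volume_ball {f : E → E} (hf : ContDiff ℝ 1 f)
    (hmaps : MapsTo f (ball 0 R) (closedBall 0 R)) (hid : ∀ x, ‖x‖ = R → f x = x) :
    ∫ x in ball (0 : E) R, (fderiv ℝ f x).det ∂ν = ν.real (ball 0 R) := by
  set u : E → E := fun x => f x - x
  have hu : ContDiff ℝ 1 u := hf.sub contDiff_id
  have hfu : ∀ x, fderiv ℝ f x = 1 + fderiv ℝ u x := fun x => by
    have hsub := ((hf.differentiable one_ne_zero x).hasFDerivAt.sub (hasFDerivAt_id x)).fderiv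
    exact eq_add_of_sub_eq' hsub.symm
  obtain ⟨K, hK⟩ := hu.contDiffOn.exists_lipschitzOnWith one_ne_zero (convex_closedBall (0 : E) R)
    (isCompact_closedBall 0 R)
  have hint : ∀ t : ℝ, IntegrableOn (fun x => (1 + t • fderiv ℝ u x).det) (ball 0 R) ν := fun t =>
    have hcont : Continuous fun x => (1 + t • fderiv ℝ u x).det :=
      ContinuousLinearMap.continuous_det.comp
        (continuous_const.add ((hu.continuous_fderiv one_ne_zero).const_smul t))
    (hcont.continuousOn.integrableOn_compact (isCompact_closedBall 0 R)).mono_set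
      ball_subset_closedBall
  obtain ⟨s, w, hs, hw, hdet⟩ :=
    exists_det_one_add_eq_sum (E := E) (ε := 1 / (K + 1)) (by positivity)
  have hsmall : ∀ t ∈ s, ∫ x in ball (0 : E) R, (1 + t • fderiv ℝ u x).det ∂ν =
      ν.real (ball 0 R) := fun t ht => by
    obtain ⟨ht0, htK⟩ := hs t ht
    rw [lt_div_iff₀ (by positivity)] at htK
    exact integral_det_one_add_smul_fderiv_eq_of_lt ν hu hK
      (fun x hx => by simpa only [u, add_sub_cancel, mem_closedBall_zero_iff] using hmaps hx)
      (fun x hx => sub_eq_zero.mpr (hid x hx)) ⟨ht0, by nlinarith [K.coe_nonneg]⟩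
      (by nlinarith)
  calc ∫ x in ball (0 : E) R, (fderiv ℝ f x).det ∂ν
      = ∫ x in ball (0 : E) R, ∑ t ∈ s, w t * (1 + t • fderiv ℝ u x).det ∂ν := by
        simp only [hfu]
        exact integral_congr_ae (.of_forall fun x => hdet _)
    _ = ∑ t ∈ s, w t * ν.real (ball 0 R) := by
        rw [integral_finsetSum _ fun t _ => (hint t).const_mul _]
        exact Finset.sum_congr rfl fun t ht => by rw [integral_const_mul, hsmall t ht]
    _ = ν.real (ball 0 R) := by rw [← Finset.sum_mul, hw, one_mul]

end Volume

section InnerProduct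

variable {E : Type*} [NormedAddCommGroup E] [InnerProductSpace ℝ E] [FiniteDimensional ℝ E]

theorem det_fderiv_eq_zero_of_norm_eq_const {f : E → E} {R : ℝ} (hR : R ≠ 0)
    (hf : Differentiable ℝ f) (hnorm : ∀ x, ‖f x‖ = R) (x : E) : (fderiv ℝ f x).det = 0 := by
  by_contra hne
  obtain ⟨y, hy⟩ := (LinearMap.equivOfDetNeZero _ hne).surjective (f x)
  have hconst : (fun z => ‖f z‖ ^ 2) = fun _ => R ^ 2 := funext fun z => by rw [hnorm]
  have hderiv := (hf x).hasFDerivAt.norm_sq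
  rw [hconst] at hderiv
  have happly := DFunLike.congr_fun (hderiv.unique (hasFDerivAt_const _ _)) y
  have hy' : fderiv ℝ f x y = f x := hy
  simp [hy', hnorm, hR] at happly

theorem exists_apply_ne_of_contDiff_of_norm_eq {f : E → E} {R : ℝ} (hR : 0 < R)
    (hf : ContDiff ℝ 1 f) (hnorm : ∀ x, ‖f x‖ = R) : ∃ x, ‖x‖ = R ∧ f x ≠ x := by
  by_contra! hid
  let _ : MeasurableSpace E := borel E
  have _ : BorelSpace E := ⟨rfl⟩
  have hvol := integral_det_fderiv_eq_volume_ball volume hf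
    (fun x _ => mem_closedBall_zero_iff.mpr (hnorm x).le) hid
  simp only [det_fderiv_eq_zero_of_norm_eq_const hR.ne' (hf.differentiable one_ne_zero) hnorm,
    integral_zero] at hvol
  exact (ENNReal.toReal_pos (measure_ball_pos volume (0 : E) hR).ne'
    measure_ball_lt_top.ne).ne hvol

theorem exists_eq_zero_of_eq_id_of_norm_ge {F : E → E} (hF : Continuous F) {r : ℝ}
    (hid : ∀ x, r ≤ ‖x‖ → F x = x) : ∃ x, F x = 0 := by
  by_contra! h0
  set R : ℝ := |r| + 1
  have hR : 0 < R := by positivity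
  have hrR : r < R := (le_abs_self r).trans_lt (lt_add_one _)
  have hclosed : IsClosed {x : E | R ≤ ‖x‖} := isClosed_le continuous_const continuous_norm
  have hnhds : {x : E | r < ‖x‖} ∈ nhdsSet {x : E | R ≤ ‖x‖} :=
    (isOpen_lt continuous_const continuous_norm).mem_nhdsSet.mpr fun x hx => hrR.trans_le hx
  obtain ⟨g, hg, hgF, hgid, -⟩ := hF.exists_contDiff_approx_and_eqOn 1 hF.norm
    (fun x => norm_pos_iff.mpr (h0 x)) hclosed hnhds
    (contDiffOn_id.congr fun x hx => hid x (le_of_lt hx))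
  have hg1 : ContDiff ℝ 1 g := hg
  have hg0 : ∀ x, ‖g x‖ ≠ 0 := fun x hx => by
    have hdist := hgF x
    rw [norm_eq_zero.mp hx, dist_zero_left] at hdist
    exact lt_irrefl _ hdist
  obtain ⟨x, hx, hne⟩ := exists_apply_ne_of_contDiff_of_norm_eq (f := fun x => (R / ‖g x‖) • g x) hR
    ((contDiff_const.div (hg1.norm ℝ fun x => norm_ne_zero_iff.mp (hg0 x)) hg0).smul hg1)
    fun x => by rw [norm_smul, norm_div, norm_norm, div_mul_cancel₀ _ (hg0 x),
      Real.norm_of_nonneg hR.le]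
  refine hne ?_
  have hgx : g x = x := (hgid hx.ge).trans (hid x (hrR.le.trans hx.ge))
  simp only [hgx, hx, div_self hR.ne', one_smul]

end InnerProduct

end NoRetraction

section Contraction

open Set

variable {X Y : Type*} [TopologicalSpace X] [TopologicalSpace Y]

theorem ContractsIn.of_section {A C : Set X} {A' C' : Set Y} (h : ContractsIn A C)
    (s : C(A', X)) (hs : ∀ a, s a ∈ A) (f : C(C, Y)) (hf : ∀ c, f c ∈ C')
    (hfs : ∀ a (ha : s a ∈ C), f ⟨s a, ha⟩ = a) : ContractsIn A' C' := by
  obtain ⟨hAC, hnull⟩ := h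
  have hsub : A' ⊆ C' := fun a ha => by
    have hfa : f ⟨s ⟨a, ha⟩, hAC (hs _)⟩ = a := hfs _ _
    exact hfa ▸ hf _
  refine ⟨hsub, ?_⟩
  convert! (hnull.comp_left ⟨fun a => ⟨s a, hs a⟩, by fun_prop⟩).comp_right
    (⟨fun c => ⟨f c, hf c⟩, by fun_prop⟩ : C(C, C')) using 1
  ext a
  exact (hfs a _).symm

theorem ContractsIn.of_image {A C : Set X} (e : X ≃ₜ Y) (h : ContractsIn (e '' A) (e '' C)) :
    ContractsIn A C :=
  h.of_section ⟨fun a => e a, by fun_prop⟩ (fun a => mem_image_of_mem e a.2)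
    ⟨fun c => e.symm c, by fun_prop⟩ (fun c => e.injective.mem_set_image.mp (by simp))
    fun a _ => e.symm_apply_apply a

theorem contractsIn_image_iff {A C : Set X} (e : X ≃ₜ Y) :
    ContractsIn (e '' A) (e '' C) ↔ ContractsIn A C := by
  refine ⟨.of_image e, fun h => .of_image e.symm ?_⟩
  simpa [image_image] using h

theorem links_image_iff {A B : Set X} (e : X ≃ₜ Y) : Links (e '' A) (e '' B) ↔ Links A B := by
  rw [Links, Links, disjoint_image_iff e.injective, ← image_compl_eq e.bijective,
    contractsIn_image_iff]

theorem contractsIn_of_segment_subset {E : Type*} [AddCommGroup E] [Module ℝ E]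
    [TopologicalSpace E] [ContinuousAdd E] [ContinuousSMul ℝ E] {A C : Set E} {y : E} (hy : y ∈ C)
    (h : ∀ x ∈ A, segment ℝ x y ⊆ C) : ContractsIn A C := by
  refine ⟨fun x hx => h x hx (left_mem_segment ℝ x y), ⟨y, hy⟩, ⟨⟨⟨fun p =>
    ⟨AffineMap.lineMap (p.2 : E) y (p.1 : ℝ), h _ p.2.2 ?_⟩, ?_⟩, fun a => ?_, fun a => ?_⟩⟩⟩
  · rw [segment_eq_image_lineMap]
    exact ⟨_, p.1.2, rfl⟩
  · simp only [AffineMap.lineMap_apply_module]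
    fun_prop
  · simp
  · simp

end Contraction

section Sphere

open Metric Set

variable {E : Type*} [NormedAddCommGroup E] [NormedSpace ℝ E]

/-- The radial projection `x ↦ x / ‖x‖` of a punctured normed space onto its unit sphere. -/
def radialProj : C(({0}ᶜ : Set E), sphere (0 : E) 1) :=
  ⟨fun x => (homeomorphUnitSphereProd E x).1, by fun_prop⟩

theorem coe_radialProj (x : ({0}ᶜ : Set E)) : (radialProj x : E) = ‖(x : E)‖⁻¹ • (x : E) := by
  simp [radialProj]

theorem radialProj_coe (x : sphere (0 : E) 1) (hx : (x : E) ∈ ({0}ᶜ : Set E)) :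
    radialProj ⟨(x : E), hx⟩ = x :=
  Subtype.ext (by simp [coe_radialProj])

theorem exists_extension_of_nullhomotopic {X : Type*} [TopologicalSpace X]
    {f : C(sphere (0 : E) 1, X)} (hf : f.Nullhomotopic) :
    ∃ F : C(E, X), ∀ x : sphere (0 : E) 1, F x = f x := by
  classical
  obtain ⟨y, ⟨G⟩⟩ := hf
  let τ : E → unitInterval := fun x => projIcc 0 1 zero_le_one (2 - 2 * ‖x‖)
  have : Continuous τ := continuous_projIcc.comp (by fun_prop)
  let F : E → X := fun x => if hx : x ≠ 0 then G (τ x, radialProj ⟨x, hx⟩) else y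
  have hF0 : F =ᶠ[nhds 0] fun _ => y := by
    filter_upwards [ball_mem_nhds (0 : E) (half_pos one_pos)] with x hx
    have hτx : τ x = 1 := projIcc_of_right_le _ (by linarith [mem_ball_zero_iff.mp hx])
    by_cases hx0 : x = 0
    · simp [F, hx0]
    · simp [F, hx0, hτx]
  have hFcont : Continuous F := continuous_iff_continuousAt.mpr fun x => by
    rcases eq_or_ne x 0 with rfl | hx
    · exact continuousAt_const.congr hF0.symm
    · have hrestrict : F ∘ Subtype.val = fun z : ({0}ᶜ : Set E) => G (τ z, radialProj z) :=
        funext fun z => dif_pos z.2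
      rw [← isOpen_compl_singleton.isOpenEmbedding_subtypeVal.continuousAt_iff (x := ⟨x, hx⟩),
        hrestrict]
      fun_prop
  refine ⟨⟨F, hFcont⟩, fun x => ?_⟩
  have hx : (x : E) ≠ 0 := ne_zero_of_mem_unit_sphere x
  have hτx : τ x = 0 := projIcc_of_le_left _ (by simp)
  have hFx : F x = f (radialProj ⟨x, hx⟩) := by simp [F, hx, hτx]
  exact hFx.trans (congrArg f (radialProj_coe x hx))

theorem not_contractsIn_sphere_of_inner {W : Type*} [NormedAddCommGroup W] [InnerProductSpace ℝ W]
    [FiniteDimensional ℝ W] : ¬ ContractsIn (sphere (0 : W) 1) {0}ᶜ := by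
  rintro ⟨_, hnull⟩
  obtain ⟨F, hF⟩ := exists_extension_of_nullhomotopic hnull
  let g : W → W := fun x => if ‖x‖ ≤ 1 then F x else x
  have hg : Continuous g := Continuous.if_le (by fun_prop) continuous_id continuous_norm
    continuous_const fun x hx => congrArg Subtype.val (hF ⟨x, mem_sphere_zero_iff_norm.mpr hx⟩)
  obtain ⟨x, hx⟩ := exists_eq_zero_of_eq_id_of_norm_ge (r := 2) hg fun x hx =>
    if_neg (by linarith)
  by_cases hx1 : ‖x‖ ≤ 1
  · exact (F x).2 (by simpa [g, hx1] using hx)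
  · have hx0 : x = 0 := by simpa [g, hx1] using hx
    simp [hx0] at hx1

theorem not_contractsIn_sphere [FiniteDimensional ℝ E] :
    ¬ ContractsIn (sphere (0 : E) 1) {0}ᶜ := by
  let e : E ≃L[ℝ] EuclideanSpace ℝ (Fin (Module.finrank ℝ E)) :=
    ContinuousLinearEquiv.ofFinrankEq (by simp)
  have he : ∀ x : ({0}ᶜ : Set E), e x ≠ 0 := fun x => e.map_ne_zero_iff.mpr x.2
  have hesymm : ∀ x : sphere (0 : EuclideanSpace ℝ (Fin (Module.finrank ℝ E))) 1, e.symm x ≠ 0 :=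
    fun x => e.symm.map_ne_zero_iff.mpr (ne_zero_of_mem_unit_sphere x)
  refine fun h => not_contractsIn_sphere_of_inner (h.of_section
    ⟨fun x => radialProj ⟨e.symm x, hesymm x⟩, by fun_prop⟩ (fun x => Subtype.coe_prop _)
    ⟨fun x => radialProj ⟨e x, he x⟩, by fun_prop⟩ (fun x => ne_zero_of_mem_unit_sphere _)
    fun x hx => ?_)
  have hnorm : ‖e.symm x‖ ≠ 0 := norm_ne_zero_iff.mpr (hesymm x)
  simp [coe_radialProj, norm_smul, smul_smul, hnorm]

theorem contractsIn_compl_of_functional {A B : Set (sphere (0 : E) 1)} (hAB : Disjoint A B)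
    (φ : E →ₗ[ℝ] ℝ) (hA : ∀ x ∈ A, 0 ≤ φ x) (hB : ∀ x ∈ B, φ x ≤ 0) {y : E} (hy : 0 < φ y) :
    ContractsIn A Bᶜ := by
  let D : Set E := {x | ∃ hx : x ≠ 0, radialProj ⟨x, hx⟩ ∉ B}
  have hpos : ∀ x, 0 < φ x → x ∈ D := fun x hx => by
    have hx0 : x ≠ 0 := fun h => by simp [h] at hx
    refine ⟨hx0, fun hxB => (hB _ hxB).not_gt ?_⟩
    rw [coe_radialProj, map_smul, smul_eq_mul]
    positivity
  have hcoe : ∀ x ∈ A, (x : E) ∈ D := fun x hx =>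
    ⟨ne_zero_of_mem_unit_sphere x, (radialProj_coe x _).symm ▸ hAB.notMem_of_mem_left hx⟩
  have hD : ContractsIn (Subtype.val '' A) D := by
    refine contractsIn_of_segment_subset (hpos y hy) ?_
    rintro _ ⟨x, hx, rfl⟩ z ⟨a, b, ha, hb, hab, rfl⟩
    rcases hb.eq_or_lt with rfl | hb0
    · rw [add_zero] at hab
      simpa [hab] using hcoe x hx
    · refine hpos _ ?_
      rw [map_add, map_smul, map_smul, smul_eq_mul, smul_eq_mul]
      have := hA x hx
      positivity
  exact hD.of_section ⟨fun a => (a : sphere (0 : E) 1), by fun_prop⟩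
    (fun a => mem_image_of_mem _ a.2) ⟨fun x => radialProj ⟨x, x.2.fst⟩, by fun_prop⟩
    (fun x => x.2.snd) fun a _ => radialProj_coe _ _

theorem not_contractsIn_of_idempotent [FiniteDimensional ℝ E] {p : E →ₗ[ℝ] E}
    (hp : ∀ x, p (p x) = p x) :
    ¬ ContractsIn {x : sphere (0 : E) 1 | p x = x} {x : sphere (0 : E) 1 | p x = 0}ᶜ := by
  have hcont : Continuous p := p.continuous_of_finiteDimensional
  have hrange : ∀ x : LinearMap.range p, p x = x := by
    rintro ⟨_, x, rfl⟩
    exact hp x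
  exact fun h => not_contractsIn_sphere (E := LinearMap.range p) (h.of_section
    ⟨fun w => ⟨w, mem_sphere_zero_iff_norm.mpr (mem_sphere_zero_iff_norm.mp w.2)⟩, by fun_prop⟩
    (fun w => hrange w)
    ⟨fun x => ⟨p x, p.mem_range_self _⟩, by fun_prop⟩
    (fun x hx => x.2 (congrArg Subtype.val hx)) fun w _ => Subtype.ext (hrange w))

end Sphere

section Spectral

open Matrix

variable {n : Type*} [Fintype n] [DecidableEq n] {m : ℕ}

theorem exp_smul_conj_diagonal {U : Matrix n n ℝ} (hU : U * Uᵀ = 1) (μ : n → ℝ) (t : ℝ) :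
    NormedSpace.exp (t • (U * diagonal μ * Uᵀ)) =
      U * diagonal (fun i => Real.exp (t * μ i)) * Uᵀ := by
  have hinv : U⁻¹ = Uᵀ := inv_eq_right_inv hU
  have hsmul : t • (U * diagonal μ * Uᵀ) = U * diagonal (t • μ) * U⁻¹ := by
    rw [hinv, diagonal_smul, Matrix.mul_smul, Matrix.smul_mul]
  have hexp : NormedSpace.exp (t • μ) = fun i => Real.exp (t * μ i) := by
    ext i
    rw [Pi.coe_exp, Real.exp_eq_exp_ℝ]
    rfl
  rw [hsmul, exp_conj U _ (.of_mul_eq_one Uᵀ hU), exp_diagonal, hinv, hexp]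

theorem exists_eq_conj_diagonal {Z : Matrix n n ℝ} (hZ : Z.IsSymm) :
    ∃ (U : Matrix n n ℝ) (μ : n → ℝ), U * Uᵀ = 1 ∧ Z = U * diagonal μ * Uᵀ := by
  have hH : Z.IsHermitian := (conjTranspose_eq_transpose_of_trivial Z).trans hZ
  have hspec := hH.spectral_theorem
  have hU : hH.eigenvectorUnitary.1 * star hH.eigenvectorUnitary.1 = 1 :=
    Unitary.coe_mul_star_self _
  rw [Unitary.conjStarAlgAut_apply] at hspec
  rw [star_eq_conjTranspose, conjTranspose_eq_transpose_of_trivial] at hspec hU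
  exact ⟨_, hH.eigenvalues, hU, hspec⟩

theorem exists_antitone_eq_conj_diagonal {Z : Matrix (Fin m) (Fin m) ℝ} (hZ : Z.IsSymm) :
    ∃ (U : Matrix (Fin m) (Fin m) ℝ) (μ : Fin m → ℝ),
      U * Uᵀ = 1 ∧ Antitone μ ∧ Z = U * diagonal μ * Uᵀ := by
  obtain ⟨U, μ, hU, rfl⟩ := exists_eq_conj_diagonal hZ
  let σ := Tuple.sort fun i => -μ i
  have hσ : Antitone (μ ∘ σ) := fun i j hij =>
    neg_le_neg_iff.mp (Tuple.monotone_sort (fun i => -μ i) hij)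
  refine ⟨U.submatrix id σ, μ ∘ σ, ?_, hσ, ?_⟩
  · rw [transpose_submatrix, submatrix_mul_equiv, hU, submatrix_id_id]
  · rw [← submatrix_diagonal_equiv, transpose_submatrix, submatrix_mul_equiv,
      submatrix_mul_equiv, submatrix_id_id]

section Orthogonal

variable {U : Matrix n n ℝ}

theorem transpose_mulVec_conj_diagonal_mulVec (hU : U * Uᵀ = 1) (μ v : n → ℝ) :
    Uᵀ *ᵥ ((U * diagonal μ * Uᵀ) *ᵥ v) = μ * (Uᵀ *ᵥ v) := by
  rw [mulVec_mulVec, ← mul_assoc, ← mul_assoc, mul_eq_one_comm.mp hU, one_mul, ← mulVec_mulVec]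
  ext i
  rw [mulVec_diagonal, Pi.mul_apply]

theorem transpose_mulVec_injective (hU : U * Uᵀ = 1) : Function.Injective (Uᵀ *ᵥ ·) :=
  Function.LeftInverse.injective (g := (U *ᵥ ·)) fun v => by simp [mulVec_mulVec, hU]

theorem conj_diagonal_mulVec_eq_smul_iff (hU : U * Uᵀ = 1) {μ v : n → ℝ} {l : ℝ} :
    (U * diagonal μ * Uᵀ) *ᵥ v = l • v ↔ ∀ i, μ i * (Uᵀ *ᵥ v) i = l * (Uᵀ *ᵥ v) i := by
  rw [← (transpose_mulVec_injective hU).eq_iff, transpose_mulVec_conj_diagonal_mulVec hU,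
    mulVec_smul, funext_iff]
  rfl

theorem dotProduct_transpose_mulVec_transpose_mulVec (hU : U * Uᵀ = 1) (v w : n → ℝ) :
    (Uᵀ *ᵥ v) ⬝ᵥ (Uᵀ *ᵥ w) = v ⬝ᵥ w := by
  rw [mulVec_transpose U v, ← dotProduct_mulVec, mulVec_mulVec, hU, one_mulVec]

theorem dotProduct_conj_diagonal_mulVec (hU : U * Uᵀ = 1) (μ v : n → ℝ) :
    v ⬝ᵥ (U * diagonal μ * Uᵀ) *ᵥ v = ∑ i, μ i * (Uᵀ *ᵥ v) i ^ 2 := by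
  rw [← dotProduct_transpose_mulVec_transpose_mulVec hU, transpose_mulVec_conj_diagonal_mulVec hU]
  exact Finset.sum_congr rfl fun i _ => by rw [Pi.mul_apply]; ring

end Orthogonal

theorem exp_smul_mulVec_of_mulVec_eq_smul {Z : Matrix n n ℝ} (hZ : Z.IsSymm) {v : n → ℝ} {l : ℝ}
    (hv : Z *ᵥ v = l • v) (t : ℝ) : NormedSpace.exp (t • Z) *ᵥ v = Real.exp (t * l) • v := by
  obtain ⟨U, μ, hU, rfl⟩ := exists_eq_conj_diagonal hZ
  rw [conj_diagonal_mulVec_eq_smul_iff hU] at hv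
  rw [exp_smul_conj_diagonal hU, conj_diagonal_mulVec_eq_smul_iff hU]
  intro i
  rcases mul_eq_mul_right_iff.mp (hv i) with h | h
  · rw [h]
  · simp [h]

theorem exists_mulVec_eq_smul_of_exp {Z : Matrix n n ℝ} (hZ : Z.IsSymm) {v : n → ℝ} {a : ℝ}
    (hv : NormedSpace.exp Z *ᵥ v = a • v) : ∃ l : ℝ, Z *ᵥ v = l • v := by
  obtain ⟨U, μ, hU, rfl⟩ := exists_eq_conj_diagonal hZ
  rw [← one_smul ℝ (U * diagonal μ * Uᵀ), exp_smul_conj_diagonal hU,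
    conj_diagonal_mulVec_eq_smul_iff hU] at hv
  refine ⟨Real.log a, (conj_diagonal_mulVec_eq_smul_iff hU).mpr fun i => ?_⟩
  rcases mul_eq_mul_right_iff.mp (hv i) with h | h
  · rw [← h, Real.log_exp, one_mul]
  · simp [h]

theorem le_of_sq_exp_mul_le {a b c C : ℝ} (hc : c ≠ 0)
    (h : ∀ t, 0 ≤ t → (Real.exp (t * a) * c) ^ 2 ≤ C * Real.exp (t * b) ^ 2) : a ≤ b := by
  by_contra! hab
  have hgrowth : Filter.Tendsto (fun t => Real.exp (t * (2 * (a - b)))) .atTop .atTop :=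
    Real.tendsto_exp_atTop.comp (Filter.tendsto_id.atTop_mul_const (by linarith))
  obtain ⟨t, hlarge, ht⟩ := ((hgrowth.eventually_gt_atTop (C / c ^ 2)).and
    (Filter.eventually_ge_atTop 0)).exists
  rw [div_lt_iff₀ (by positivity)] at hlarge
  refine (h t ht).not_gt ?_
  calc C * Real.exp (t * b) ^ 2
      < Real.exp (t * (2 * (a - b))) * c ^ 2 * Real.exp (t * b) ^ 2 := by gcongr
    _ = (Real.exp (t * a) * c) ^ 2 := by
      rw [mul_pow, ← Real.exp_nat_mul, ← Real.exp_nat_mul, mul_right_comm, ← Real.exp_add]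
      push_cast
      ring_nf

theorem rayleigh_le_of_exp_growth {Z : Matrix n n ℝ} (hZ : Z.IsSymm) {v : n → ℝ} {l C : ℝ}
    (h : ∀ t : ℝ, 0 ≤ t → (NormedSpace.exp (t • Z) *ᵥ v) ⬝ᵥ (NormedSpace.exp (t • Z) *ᵥ v)
      ≤ C * Real.exp (t * l) ^ 2) :
    v ⬝ᵥ Z *ᵥ v ≤ l * (v ⬝ᵥ v) ∧ (v ⬝ᵥ Z *ᵥ v = l * (v ⬝ᵥ v) → Z *ᵥ v = l • v) := by
  obtain ⟨U, μ, hU, rfl⟩ := exists_eq_conj_diagonal hZ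
  have hle : ∀ i, (Uᵀ *ᵥ v) i ≠ 0 → μ i ≤ l := fun i hi => le_of_sq_exp_mul_le hi fun t ht => by
    refine le_trans ?_ (h t ht)
    rw [← dotProduct_transpose_mulVec_transpose_mulVec hU, exp_smul_conj_diagonal hU,
      transpose_mulVec_conj_diagonal_mulVec hU]
    rw [sq]
    exact Finset.single_le_sum (f := fun j => (Real.exp (t * μ j) * (Uᵀ *ᵥ v) j) *
      (Real.exp (t * μ j) * (Uᵀ *ᵥ v) j)) (fun j _ => mul_self_nonneg _) (Finset.mem_univ i)
  have hterm : ∀ i, μ i * (Uᵀ *ᵥ v) i ^ 2 ≤ l * (Uᵀ *ᵥ v) i ^ 2 := fun i => by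
    by_cases hi : (Uᵀ *ᵥ v) i = 0
    · simp [hi]
    · gcongr
      exact hle i hi
  rw [dotProduct_conj_diagonal_mulVec hU, ← dotProduct_transpose_mulVec_transpose_mulVec hU,
    dotProduct, Finset.mul_sum]
  simp only [← sq]
  refine ⟨Finset.sum_le_sum fun i _ => hterm i, fun heq => ?_⟩
  rw [conj_diagonal_mulVec_eq_smul_iff hU]
  intro i
  by_cases hi : (Uᵀ *ᵥ v) i = 0
  · simp [hi]
  · have := (Finset.sum_eq_sum_iff_of_le fun i _ => hterm i).mp heq i (Finset.mem_univ i)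
    rw [mul_right_cancel₀ (pow_ne_zero 2 hi) this]

theorem exists_orthogonal_transpose_mul_blockTriangular (M : Matrix (Fin m) (Fin m) ℝ) :
    ∃ k : Matrix (Fin m) (Fin m) ℝ, k * kᵀ = 1 ∧ (kᵀ * M).BlockTriangular id := by
  let f : Fin m → EuclideanSpace ℝ (Fin m) := fun j => WithLp.toLp 2 (M.col j)
  let b := InnerProductSpace.gramSchmidtOrthonormalBasis (𝕜 := ℝ) (by simp) f
  refine ⟨of fun i j => b j i, mul_eq_one_comm.mp ?_, fun i j hij => ?_⟩
  · ext i j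
    rw [one_apply, ← orthonormal_iff_ite.mp b.orthonormal i j]
    simp [mul_apply, PiLp.inner_apply, mul_comm]
  · rw [← InnerProductSpace.gramSchmidtOrthonormalBasis_inv_triangular (𝕜 := ℝ) (by simp) f hij]
    simp [mul_apply, PiLp.inner_apply, f, b, mul_comm]

end Spectral

section Distance

open Matrix
open scoped Matrix.Norms.Frobenius MatrixGroups

variable {l n : Type*} [Fintype l] [Fintype n] {m : ℕ}

theorem frobenius_norm_sq_eq_sum (M : Matrix l n ℝ) : ‖M‖ ^ 2 = ∑ i, ∑ j, M i j ^ 2 := by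
  rw [frobenius_norm_def, ← Real.sqrt_eq_rpow, Real.sq_sqrt (by positivity)]
  simp

theorem frobenius_norm_sq_eq_trace (M : Matrix l n ℝ) : ‖M‖ ^ 2 = (M * Mᵀ).trace := by
  rw [frobenius_norm_sq_eq_sum]
  simp only [trace, diag_apply, mul_apply, transpose_apply, sq]

theorem frobenius_norm_mul_orthogonal [DecidableEq n] (M : Matrix l n ℝ) {U : Matrix n n ℝ}
    (hU : U * Uᵀ = 1) : ‖M * U‖ = ‖M‖ := by
  rw [← sq_eq_sq₀ (norm_nonneg _) (norm_nonneg _), frobenius_norm_sq_eq_trace, transpose_mul,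
    Matrix.mul_assoc, ← Matrix.mul_assoc U, hU, Matrix.one_mul, frobenius_norm_sq_eq_trace]

theorem frobenius_norm_orthogonal_mul [DecidableEq l] (M : Matrix l n ℝ) {U : Matrix l l ℝ}
    (hU : U * Uᵀ = 1) : ‖U * M‖ = ‖M‖ := by
  rw [← frobenius_norm_transpose, transpose_mul, frobenius_norm_mul_orthogonal _
    (by rw [transpose_transpose, mul_eq_one_comm.mp hU]), frobenius_norm_transpose]

theorem abs_le_card_mul_of_sum_eq_zero {x : n → ℝ} (hsum : ∑ i, x i = 0) {c : ℝ}
    (hx : ∀ i, x i ≤ c) (i : n) : |x i| ≤ Fintype.card n * c := by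
  classical
  have hle : ∑ j, (c - x j) = Fintype.card n * c := by
    rw [Finset.sum_sub_distrib, hsum, sub_zero, Finset.sum_const, nsmul_eq_mul, Finset.card_univ]
  have hi := (Finset.single_le_sum (fun j _ => sub_nonneg.mpr (hx j)) (Finset.mem_univ i)).trans_eq
    hle
  have hcard : (1 : ℝ) ≤ Fintype.card n := by
    exact_mod_cast Fintype.card_pos_iff.mpr ⟨i⟩
  have hc : 0 ≤ c := by
    by_contra! hc
    have : ∑ j, x j < 0 := Finset.sum_neg (fun j _ => (hx j).trans_lt hc) ⟨i, Finset.mem_univ i⟩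
    linarith
  rw [abs_le]
  constructor <;> nlinarith [hx i]

theorem coe_inv_mul_coe (a : SL(m, ℝ)) : (a⁻¹).1 * a.1 = 1 :=
  congrArg Subtype.val (inv_mul_cancel a)

theorem coe_mul_coe_inv (a : SL(m, ℝ)) : a.1 * (a⁻¹).1 = 1 :=
  congrArg Subtype.val (mul_inv_cancel a)

theorem gram_mk (a : SL(m, ℝ)) : gram (QuotientGroup.mk a : SymSpace m) = a.1 * a.1ᵀ :=
  rfl

theorem inv_gram_mk (a : SL(m, ℝ)) :
    (gram (QuotientGroup.mk a : SymSpace m))⁻¹ = (a⁻¹).1ᵀ * (a⁻¹).1 := by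
  refine inv_eq_left_inv ?_
  rw [gram_mk, mul_assoc, ← mul_assoc _ a.1, coe_inv_mul_coe, one_mul, ← transpose_mul,
    coe_mul_coe_inv, transpose_one]

theorem exists_sdist_eq (a b : SL(m, ℝ)) :
    ∃ x : Fin m → ℝ, ∑ i, x i = 0 ∧ ∑ i, Real.exp (2 * x i) = ‖(a⁻¹ * b).1‖ ^ 2 ∧
      sdist (QuotientGroup.mk a : SymSpace m) (QuotientGroup.mk b) = √(∑ i, x i ^ 2) := by
  set c := a⁻¹ * b
  have hpos : (c.1 * c.1ᵀ).PosDef := by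
    rw [← conjTranspose_eq_transpose_of_trivial]
    exact .mul_conjTranspose_self _ (vecMul_injective_of_isUnit
      (.of_mul_eq_one _ (coe_mul_coe_inv c)))
  have hH := hpos.isHermitian
  refine ⟨fun i => Real.log (hH.eigenvalues i) / 2, ?_, ?_, ?_⟩
  · have hdet := hH.det_eq_prod_eigenvalues
    rw [det_mul, det_transpose, c.2, mul_one] at hdet
    rw [← Finset.sum_div, ← Real.log_prod fun i _ => (hpos.eigenvalues_pos i).ne']
    simp only [RCLike.ofReal_real_eq_id, id_eq] at hdet
    rw [← hdet, Real.log_one, zero_div]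
  · simp only [mul_div_cancel₀ _ (two_ne_zero' ℝ), Real.exp_log (hpos.eigenvalues_pos _)]
    rw [frobenius_norm_sq_eq_trace, hH.trace_eq_sum_eigenvalues]
    rfl
  · have hchar : ((gram (QuotientGroup.mk a : SymSpace m))⁻¹ *
        gram (QuotientGroup.mk b)).charpoly = (c.1 * c.1ᵀ).charpoly := by
      have hcoe : c.1 = (a⁻¹).1 * b.1 := rfl
      rw [inv_gram_mk, gram_mk, mul_assoc, charpoly_mul_comm, hcoe, transpose_mul]
      simp only [mul_assoc]
    rw [sdist, hchar, hH.roots_charpoly_eq_eigenvalues, Multiset.map_map]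
    rfl

theorem norm_sq_le_of_sdist_le {a b : SL(m, ℝ)} {C : ℝ}
    (h : sdist (QuotientGroup.mk a : SymSpace m) (QuotientGroup.mk b) ≤ C) :
    ‖(a⁻¹ * b).1‖ ^ 2 ≤ m * Real.exp (2 * C) := by
  obtain ⟨x, -, hnorm, hdist⟩ := exists_sdist_eq a b
  have hx : ∀ i, x i ≤ C := fun i => by
    rw [hdist] at h
    exact (Real.le_sqrt_of_sq_le (Finset.single_le_sum (fun j _ => sq_nonneg (x j))
      (Finset.mem_univ i))).trans h
  calc ‖(a⁻¹ * b).1‖ ^ 2 = ∑ i, Real.exp (2 * x i) := hnorm.symm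
    _ ≤ ∑ _i : Fin m, Real.exp (2 * C) := by gcongr with i; exact hx i
    _ = m * Real.exp (2 * C) := by simp

theorem exists_forall_sdist_le_of_norm_le (m : ℕ) (c : ℝ) : ∃ C : ℝ, ∀ a b : SL(m, ℝ),
    ‖(a⁻¹ * b).1‖ ≤ c → sdist (QuotientGroup.mk a : SymSpace m) (QuotientGroup.mk b) ≤ C := by
  refine ⟨√(∑ _i : Fin m, (m * Real.log c) ^ 2), fun a b h => ?_⟩
  obtain ⟨x, hsum, hnorm, hdist⟩ := exists_sdist_eq a b
  have hx : ∀ i, x i ≤ Real.log c := fun i => by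
    have hexp : Real.exp (x i) ≤ ‖(a⁻¹ * b).1‖ := by
      refine le_of_sq_le_sq ?_ (norm_nonneg _)
      rw [← hnorm, ← Real.exp_nat_mul]
      exact Finset.single_le_sum (f := fun i => Real.exp (2 * x i)) (fun _ _ => by positivity)
        (Finset.mem_univ i)
    rw [Real.le_log_iff_exp_le ((Real.exp_pos _).trans_le (hexp.trans h))]
    exact hexp.trans h
  rw [hdist]
  gcongr √(∑ i, ?_) with i
  rw [sq_le_sq]
  exact (by simpa using abs_le_card_mul_of_sum_eq_zero hsum hx i : |x i| ≤ _).trans (le_abs_self _)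

end Distance

section VisualSphere

open Matrix
open scoped Matrix.Norms.Frobenius

variable {m : ℕ}

/-- The tangent space at the base point: the symmetric traceless matrices. -/
def symTraceless (m : ℕ) : Submodule ℝ (Matrix (Fin m) (Fin m) ℝ) where
  carrier := {Z | Z.IsSymm ∧ Z.trace = 0}
  add_mem' hA hB := ⟨hA.1.add hB.1, by rw [trace_add, hA.2, hB.2, add_zero]⟩
  zero_mem' := ⟨isSymm_zero, trace_zero _ _⟩
  smul_mem' c _ hA := ⟨hA.1.smul c, by rw [trace_smul, hA.2, smul_zero]⟩

theorem VisualSphere.mem_symTraceless (Z : VisualSphere m) : Z.1 ∈ symTraceless m :=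
  ⟨Z.2.1, Z.2.2.1⟩

theorem VisualSphere.norm_eq_one (Z : VisualSphere m) : ‖Z.1‖ = 1 := by
  rw [← sq_eq_sq₀ (norm_nonneg _) zero_le_one, frobenius_norm_sq_eq_sum, Z.2.2.2, one_pow]

/-- The visual sphere as the unit sphere of the tangent space with the Frobenius norm. -/
def visualSphereHomeo (m : ℕ) : VisualSphere m ≃ₜ Metric.sphere (0 : symTraceless m) 1 where
  toFun Z := ⟨⟨Z.1, Z.mem_symTraceless⟩, mem_sphere_zero_iff_norm.mpr Z.norm_eq_one⟩
  invFun Z := ⟨Z.1.1, Z.1.2.1, Z.1.2.2, by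
    rw [← frobenius_norm_sq_eq_sum]
    exact (congrArg (· ^ 2) (mem_sphere_zero_iff_norm.mp Z.2)).trans (one_pow 2)⟩
  left_inv _ := rfl
  right_inv _ := rfl
  continuous_toFun := by fun_prop
  continuous_invFun := by fun_prop

theorem VisualSphere.contractsIn_compl_of_functional {A B : Set (VisualSphere m)}
    (hAB : Disjoint A B) (φ : Matrix (Fin m) (Fin m) ℝ →ₗ[ℝ] ℝ) (hA : ∀ Z ∈ A, 0 ≤ φ Z.1)
    (hB : ∀ Z ∈ B, φ Z.1 ≤ 0) {Y : Matrix (Fin m) (Fin m) ℝ} (hY : Y ∈ symTraceless m)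
    (hφY : 0 < φ Y) : ContractsIn A Bᶜ := by
  rw [← contractsIn_image_iff (visualSphereHomeo m), Set.image_compl_eq (Homeomorph.bijective _)]
  refine SLSymm.contractsIn_compl_of_functional (Set.disjoint_image_iff
    (Homeomorph.injective _) |>.mpr hAB) (φ ∘ₗ (symTraceless m).subtype) ?_ ?_ (y := ⟨Y, hY⟩) hφY
  · rintro _ ⟨Z, hZ, rfl⟩
    exact hA Z hZ
  · rintro _ ⟨Z, hZ, rfl⟩
    exact hB Z hZ

theorem VisualSphere.not_contractsIn_of_idempotent
    {p : Matrix (Fin m) (Fin m) ℝ →ₗ[ℝ] Matrix (Fin m) (Fin m) ℝ}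
    (hmaps : ∀ Z ∈ symTraceless m, p Z ∈ symTraceless m) (hidem : ∀ Z, p (p Z) = p Z) :
    ¬ ContractsIn {Z : VisualSphere m | p Z.1 = Z.1} {Z : VisualSphere m | p Z.1 = 0}ᶜ := by
  have himage : ∀ q : Matrix (Fin m) (Fin m) ℝ →ₗ[ℝ] Matrix (Fin m) (Fin m) ℝ,
      ∀ hq : ∀ Z ∈ symTraceless m, q Z ∈ symTraceless m,
      visualSphereHomeo m '' {Z | p Z.1 = q Z.1} =
        {Z : Metric.sphere (0 : symTraceless m) 1 |
          p.restrict hmaps Z = q.restrict hq Z} := fun q hq => by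
    rw [Homeomorph.image_eq_preimage_symm]
    ext Z
    exact (Subtype.ext_iff (a1 := p.restrict hmaps Z.1) (a2 := q.restrict hq Z.1)).symm
  rw [← contractsIn_image_iff (visualSphereHomeo m), Set.image_compl_eq (Homeomorph.bijective _)]
  convert! SLSymm.not_contractsIn_of_idempotent (p := p.restrict hmaps)
    fun Z => Subtype.ext (hidem Z) using 2
  · exact himage LinearMap.id fun _ => id
  · exact congrArg (·ᶜ) (himage 0 fun _ _ => zero_mem _)

end VisualSphere

section AsymptoticRays

open Matrix
open scoped Matrix.Norms.Frobenius MatrixGroups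

variable {m : ℕ} {g h : SL(m, ℝ)} {Z ξ ζ : VisualSphere m}

theorem coe_expSL (Z : VisualSphere m) (t : ℝ) : (expSL Z t).1 = NormedSpace.exp (t • Z.1) :=
  rfl

theorem inv_expSL (Z : VisualSphere m) (t : ℝ) : (expSL Z t)⁻¹ = expSL Z (-t) := by
  refine inv_eq_of_mul_eq_one_right (Subtype.ext ?_)
  change NormedSpace.exp (t • Z.1) * NormedSpace.exp (-t • Z.1) = 1
  rw [← Matrix.exp_add_of_commute _ _ (((Commute.refl Z.1).smul_left t).smul_right (-t)),
    ← add_smul, add_neg_cancel, zero_smul, NormedSpace.exp_zero]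

theorem transpose_expSL (Z : VisualSphere m) (t : ℝ) : (expSL Z t).1ᵀ = (expSL Z t).1 :=
  IsSymm.exp (Z.2.1.smul t)

theorem continuous_expSL (t : ℝ) : Continuous fun Z : VisualSphere m => expSL Z t :=
  .subtype_mk (NormedSpace.exp_continuous.comp (continuous_subtype_val.const_smul t)) _

theorem isCompact_setOf_norm_le (c : ℝ) : IsCompact {a : SL(m, ℝ) | ‖a.1‖ ≤ c} := by
  have hproper : ProperSpace (Matrix (Fin m) (Fin m) ℝ) := FiniteDimensional.proper_real _
  simp only [← mem_closedBall_zero_iff]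
  exact SpecialLinearGroup.isClosedEmbedding_val.isCompact_preimage (isCompact_closedBall _ c)

theorem exists_forall_norm_inv_le (m : ℕ) (c : ℝ) :
    ∃ C, ∀ a : SL(m, ℝ), ‖a.1‖ ≤ c → ‖(a⁻¹).1‖ ≤ C := by
  obtain ⟨C, hC⟩ := (isCompact_setOf_norm_le (m := m) c).inv.image
    (f := fun a : SL(m, ℝ) => ‖a.1‖) continuous_subtype_val.norm |>.bddAbove
  exact ⟨C, fun a ha => hC ⟨a⁻¹, Set.mem_inv.mpr (by rwa [inv_inv]), rfl⟩⟩

/-- The ray `t ↦ g exp(tZ) · o` is asymptotic to the ray `t ↦ exp(tξ) · o` issuing from the base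
point `o`, expressed by the boundedness of their relative position. -/
def RayAsymptotic (g : SL(m, ℝ)) (Z ξ : VisualSphere m) : Prop :=
  ∃ c : ℝ, ∀ t : ℝ, 0 ≤ t → ‖((expSL ξ t)⁻¹ * g * expSL Z t).1‖ ≤ c

theorem RayAsymptotic.refl (Z : VisualSphere m) : RayAsymptotic 1 Z Z :=
  ⟨‖(1 : SL(m, ℝ)).1‖, fun t _ => by rw [mul_one, inv_mul_cancel]⟩

theorem RayAsymptotic.inv (hg : RayAsymptotic g Z ξ) : RayAsymptotic g⁻¹ ξ Z := by
  obtain ⟨c, hc⟩ := hg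
  obtain ⟨C, hC⟩ := exists_forall_norm_inv_le m c
  refine ⟨C, fun t ht => ?_⟩
  convert hC _ (hc t ht) using 3
  group

theorem RayAsymptotic.trans (hg : RayAsymptotic g Z ξ) (hh : RayAsymptotic h ξ ζ) :
    RayAsymptotic (h * g) Z ζ := by
  obtain ⟨c, hc⟩ := hg
  obtain ⟨d, hd⟩ := hh
  refine ⟨d * c, fun t ht => ?_⟩
  have hsplit : (expSL ζ t)⁻¹ * (h * g) * expSL Z t =
      (expSL ζ t)⁻¹ * h * expSL ξ t * ((expSL ξ t)⁻¹ * g * expSL Z t) := by group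
  rw [hsplit]
  exact (norm_mul_le _ _).trans (mul_le_mul (hd t ht) (hc t ht) (norm_nonneg _)
    ((norm_nonneg _).trans (hd t ht)))

theorem asymptotic_geodesic_iff :
    Asymptotic (geodesic g Z) (geodesic 1 ξ) ↔ RayAsymptotic g Z ξ := by
  have hrel : ∀ t, (g * expSL Z t)⁻¹ * (1 * expSL ξ t) = (expSL Z t)⁻¹ * g⁻¹ * expSL ξ t :=
    fun t => by group
  constructor
  · rintro ⟨C, hC⟩
    rw [← inv_inv g]
    refine RayAsymptotic.inv ⟨√(m * Real.exp (2 * C)), fun t ht => ?_⟩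
    rw [← hrel]
    exact Real.le_sqrt_of_sq_le (norm_sq_le_of_sdist_le (hC t ht))
  · intro hg
    obtain ⟨c, hc⟩ := hg.inv
    obtain ⟨C, hC⟩ := exists_forall_sdist_le_of_norm_le m c
    exact ⟨C, fun t ht => hC _ _ (hrel t ▸ hc t ht)⟩

theorem dotProduct_self_mulVec_le (M : Matrix (Fin m) (Fin m) ℝ) (v : Fin m → ℝ) :
    (M *ᵥ v) ⬝ᵥ (M *ᵥ v) ≤ ‖M‖ ^ 2 * (v ⬝ᵥ v) := by
  simp only [frobenius_norm_sq_eq_sum, dotProduct, mulVec, Finset.sum_mul, ← sq]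
  gcongr with i
  simpa only [← Finset.sum_mul] using Finset.sum_mul_sq_le_sq_mul_sq Finset.univ (M i) v

theorem dotProduct_self_mulVec_smul_le {M : Matrix (Fin m) (Fin m) ℝ} {c : ℝ} (hM : ‖M‖ ≤ c)
    (r : ℝ) (v : Fin m → ℝ) :
    (M *ᵥ (r • v)) ⬝ᵥ (M *ᵥ (r • v)) ≤ c ^ 2 * (v ⬝ᵥ v) * r ^ 2 := by
  have hv : 0 ≤ v ⬝ᵥ v := Finset.sum_nonneg fun i _ => mul_self_nonneg _
  calc (M *ᵥ (r • v)) ⬝ᵥ (M *ᵥ (r • v)) = (M *ᵥ v) ⬝ᵥ (M *ᵥ v) * r ^ 2 := by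
        rw [mulVec_smul, smul_dotProduct, dotProduct_smul, smul_eq_mul, smul_eq_mul]
        ring
    _ ≤ ‖M‖ ^ 2 * (v ⬝ᵥ v) * r ^ 2 := by
        gcongr
        exact dotProduct_self_mulVec_le M v
    _ ≤ c ^ 2 * (v ⬝ᵥ v) * r ^ 2 := by gcongr

theorem RayAsymptotic.rayleigh_le (hg : RayAsymptotic g Z ξ) {l : ℝ} {φ : Fin m → ℝ}
    (hφ : Z.1 *ᵥ (g.1ᵀ *ᵥ φ) = l • (g.1ᵀ *ᵥ φ)) :
    φ ⬝ᵥ ξ.1 *ᵥ φ ≤ l * (φ ⬝ᵥ φ) ∧ (φ ⬝ᵥ ξ.1 *ᵥ φ = l * (φ ⬝ᵥ φ) → ξ.1 *ᵥ φ = l • φ) := by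
  obtain ⟨c, hc⟩ := hg.inv
  refine rayleigh_le_of_exp_growth ξ.2.1
    (C := c ^ 2 * ((g.1ᵀ *ᵥ φ) ⬝ᵥ (g.1ᵀ *ᵥ φ))) fun t ht => ?_
  have hfactor : expSL ξ t = g * expSL Z t * ((expSL Z t)⁻¹ * g⁻¹ * expSL ξ t) := by group
  have hexp : NormedSpace.exp (t • ξ.1) =
      ((expSL Z t)⁻¹ * g⁻¹ * expSL ξ t).1ᵀ * ((expSL Z t).1 * g.1ᵀ) := by
    rw [← coe_expSL, ← transpose_expSL ξ, ← transpose_expSL Z, ← transpose_mul, ← transpose_mul]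
    exact congrArg (fun a : SL(m, ℝ) => a.1ᵀ) hfactor
  rw [hexp, ← mulVec_mulVec, ← mulVec_mulVec, coe_expSL Z,
    exp_smul_mulVec_of_mulVec_eq_smul Z.2.1 hφ]
  exact dotProduct_self_mulVec_smul_le ((frobenius_norm_transpose _).trans_le (hc t ht)) _ _

theorem RayAsymptotic.le_rayleigh (hg : RayAsymptotic g Z ξ) {l : ℝ} {x : Fin m → ℝ}
    (hx : Z.1 *ᵥ x = l • x) :
    l * ((g.1 *ᵥ x) ⬝ᵥ (g.1 *ᵥ x)) ≤ (g.1 *ᵥ x) ⬝ᵥ ξ.1 *ᵥ (g.1 *ᵥ x) ∧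
      ((g.1 *ᵥ x) ⬝ᵥ ξ.1 *ᵥ (g.1 *ᵥ x) = l * ((g.1 *ᵥ x) ⬝ᵥ (g.1 *ᵥ x)) →
        ξ.1 *ᵥ (g.1 *ᵥ x) = l • (g.1 *ᵥ x)) := by
  obtain ⟨c, hc⟩ := hg
  have hgrowth := rayleigh_le_of_exp_growth (Z := -ξ.1) (v := g.1 *ᵥ x) (l := -l)
    (C := c ^ 2 * (x ⬝ᵥ x)) ξ.2.1.neg fun t ht => by
      have hfactor : expSL ξ (-t) * g = (expSL ξ t)⁻¹ * g * expSL Z t * expSL Z (-t) := by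
        rw [← inv_expSL, ← inv_expSL]
        group
      have hexp : NormedSpace.exp (t • -ξ.1) * g.1 =
          ((expSL ξ t)⁻¹ * g * expSL Z t).1 * (expSL Z (-t)).1 := by
        rw [smul_neg, ← neg_smul]
        exact congrArg Subtype.val hfactor
      rw [mulVec_mulVec, hexp, ← mulVec_mulVec, coe_expSL Z,
        exp_smul_mulVec_of_mulVec_eq_smul Z.2.1 hx, neg_mul, ← mul_neg]
      exact dotProduct_self_mulVec_smul_le (hc t ht) _ _
  simpa only [neg_mulVec, dotProduct_neg, neg_mul, neg_le_neg_iff, neg_inj, neg_smul] using hgrowth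

theorem eq_of_forall_mulVec_eq_smul {n : Type*} [Fintype n] {A B : Matrix n n ℝ} (hA : A.IsSymm)
    (h : ∀ (l : ℝ) (x : n → ℝ), A *ᵥ x = l • x → B *ᵥ x = l • x) : B = A := by
  classical
  obtain ⟨U, μ, hU, rfl⟩ := exists_eq_conj_diagonal hA
  have hcol : ∀ j, (U * diagonal μ * Uᵀ) *ᵥ (U *ᵥ Pi.single j 1) = μ j • U *ᵥ Pi.single j 1 := by
    intro j
    rw [conj_diagonal_mulVec_eq_smul_iff hU, mulVec_mulVec, mul_eq_one_comm.mp hU, one_mulVec]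
    intro i
    rcases eq_or_ne i j with rfl | hij
    · rfl
    · simp [hij]
  have hBU : B * U = U * diagonal μ * Uᵀ * U := ext_of_mulVec_single fun j => by
    rw [← mulVec_mulVec, h _ _ (hcol j), ← mulVec_mulVec, hcol]
  rw [← mul_one B, ← hU, ← mul_assoc, hBU, mul_assoc, hU, mul_one]

theorem RayAsymptotic.eq (h1 : RayAsymptotic 1 Z ξ) : ξ = Z := by
  refine Subtype.ext (eq_of_forall_mulVec_eq_smul Z.2.1 fun l x hx => ?_)
  have hone : (1 : SL(m, ℝ)).1 = 1 := rfl
  have hupper := h1.rayleigh_le (φ := x) (l := l) (by rwa [hone, transpose_one, one_mulVec])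
  exact hupper.2 (hupper.1.antisymm (by simpa [hone] using (h1.le_rayleigh hx).1))

end AsymptoticRays

section Translation

open Matrix
open scoped Matrix.Norms.Frobenius MatrixGroups

variable {m : ℕ}

theorem norm_exp_conj_blockTriangular_le {T : Matrix (Fin m) (Fin m) ℝ} (hT : T.BlockTriangular id)
    {μ : Fin m → ℝ} (hμ : Antitone μ) {t : ℝ} (ht : 0 ≤ t) :
    ‖diagonal (fun i => Real.exp (-t * μ i)) * T * diagonal fun i => Real.exp (t * μ i)‖ ≤ ‖T‖ := by
  refine le_of_sq_le_sq ?_ (norm_nonneg T)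
  simp only [frobenius_norm_sq_eq_sum, mul_diagonal, diagonal_mul]
  refine Finset.sum_le_sum fun i _ => Finset.sum_le_sum fun j _ => ?_
  rcases lt_or_ge j i with hji | hij
  · simp [hT hji]
  · have hcomm : Real.exp (-t * μ i) * T i j * Real.exp (t * μ j) =
        Real.exp (t * (μ j - μ i)) * T i j := by
      rw [mul_right_comm, ← Real.exp_add]
      ring_nf
    have hexp : Real.exp (t * (μ j - μ i)) ≤ 1 :=
      Real.exp_le_one_iff.mpr (mul_nonpos_of_nonneg_of_nonpos ht (sub_nonpos.mpr (hμ hij)))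
    rw [hcomm, mul_pow]
    exact mul_le_of_le_one_left (sq_nonneg _) (pow_le_one₀ (Real.exp_nonneg _) hexp)

/-- The conjugate `k Z kᵀ` of a direction by an orthogonal matrix, possibly of determinant `-1`. -/
def VisualSphere.conj (Z : VisualSphere m) (k : Matrix (Fin m) (Fin m) ℝ) (hk : k * kᵀ = 1) :
    VisualSphere m :=
  ⟨k * Z.1 * kᵀ,
    by rw [IsSymm, transpose_mul, transpose_mul, transpose_transpose, Z.2.1, mul_assoc],
    by rw [trace_mul_comm, ← mul_assoc, mul_eq_one_comm.mp hk, one_mul, Z.2.2.1], by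
      rw [← frobenius_norm_sq_eq_sum, frobenius_norm_mul_orthogonal _ (by
        rw [transpose_transpose, mul_eq_one_comm.mp hk]), frobenius_norm_orthogonal_mul _ hk,
        Z.norm_eq_one, one_pow]⟩

/-- By the Iwasawa decomposition `g U = k T` in an eigenbasis `U` of `Z`, the matrix
`exp(-tξ) g exp(tZ)` is, up to orthogonal factors, `T` conjugated by a contracting flow. -/
theorem exists_forall_norm_le (g : SL(m, ℝ)) (Z : VisualSphere m) :
    ∃ ξ : VisualSphere m, ∀ t : ℝ, 0 ≤ t →
      ‖((expSL ξ t)⁻¹ * g * expSL Z t).1‖ ≤ ‖g.1‖ := by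
  obtain ⟨U, μ, hU, hμ, hZ⟩ := exists_antitone_eq_conj_diagonal Z.2.1
  obtain ⟨k, hk, hT⟩ := exists_orthogonal_transpose_mul_blockTriangular (g.1 * U)
  have hUt : Uᵀ * Uᵀᵀ = 1 := by rw [transpose_transpose, mul_eq_one_comm.mp hU]
  have hkt : kᵀ * kᵀᵀ = 1 := by rw [transpose_transpose, mul_eq_one_comm.mp hk]
  let ξ := (Z.conj Uᵀ hUt).conj k hk
  have hdiag : Uᵀ * Z.1 * Uᵀᵀ = diagonal μ := by
    rw [hZ, transpose_transpose, ← mul_assoc, ← mul_assoc, mul_eq_one_comm.mp hU, one_mul,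
      mul_assoc, mul_eq_one_comm.mp hU, mul_one]
  have hξ : ξ.1 = k * diagonal μ * kᵀ := congrArg (fun M => k * M * kᵀ) hdiag
  refine ⟨ξ, fun t ht => ?_⟩
  have hconj : ((expSL ξ t)⁻¹ * g * expSL Z t).1 = k * (diagonal (fun i => Real.exp (-t * μ i)) *
      (kᵀ * (g.1 * U)) * diagonal fun i => Real.exp (t * μ i)) * Uᵀ := by
    rw [inv_expSL]
    change NormedSpace.exp (-t • ξ.1) * g.1 * NormedSpace.exp (t • Z.1) = _
    rw [hξ, hZ, exp_smul_conj_diagonal hk, exp_smul_conj_diagonal hU]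
    simp only [mul_assoc]
  calc ‖((expSL ξ t)⁻¹ * g * expSL Z t).1‖
      ≤ ‖kᵀ * (g.1 * U)‖ := by
        rw [hconj, frobenius_norm_mul_orthogonal _ hUt, frobenius_norm_orthogonal_mul _ hk]
        exact norm_exp_conj_blockTriangular_le hT hμ ht
    _ = ‖g.1‖ := by
        rw [frobenius_norm_orthogonal_mul _ hkt, frobenius_norm_mul_orthogonal _ hU]

/-- The action of `SL_m(ℝ)` on the visual sphere by translating rays: the direction at the base
point of the ray asymptotic to `t ↦ g exp(tZ) · o`. -/
def translate (g : SL(m, ℝ)) (Z : VisualSphere m) : VisualSphere m :=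
  (exists_forall_norm_le g Z).choose

theorem norm_translate_le (g : SL(m, ℝ)) (Z : VisualSphere m) {t : ℝ} (ht : 0 ≤ t) :
    ‖((expSL (translate g Z) t)⁻¹ * g * expSL Z t).1‖ ≤ ‖g.1‖ :=
  (exists_forall_norm_le g Z).choose_spec t ht

theorem rayAsymptotic_iff_translate_eq {g : SL(m, ℝ)} {Z ξ : VisualSphere m} :
    RayAsymptotic g Z ξ ↔ translate g Z = ξ := by
  have htranslate : RayAsymptotic g Z (translate g Z) := ⟨_, fun t ht => norm_translate_le g Z ht⟩
  refine ⟨fun h => ?_, fun h => h ▸ htranslate⟩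
  have hone := h.inv.trans htranslate
  rw [mul_inv_cancel] at hone
  exact hone.eq

theorem translate_inv_translate (g : SL(m, ℝ)) (Z : VisualSphere m) :
    translate g⁻¹ (translate g Z) = Z :=
  rayAsymptotic_iff_translate_eq.mp (rayAsymptotic_iff_translate_eq.mpr rfl).inv

instance : CompactSpace (VisualSphere m) :=
  have : ProperSpace (symTraceless m) := FiniteDimensional.proper_real _
  have : CompactSpace (Metric.sphere (0 : symTraceless m) 1) :=
    isCompact_iff_compactSpace.mp (isCompact_sphere _ _)
  (visualSphereHomeo m).symm.compactSpace

theorem continuous_of_isClosed_graph {X Y : Type*} [TopologicalSpace X] [TopologicalSpace Y]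
    [CompactSpace Y] {f : X → Y} (hf : IsClosed {p : X × Y | f p.1 = p.2}) : Continuous f := by
  refine continuous_iff_isClosed.mpr fun s hs => ?_
  convert isClosedMap_fst_of_compactSpace _ (hf.inter (hs.preimage continuous_snd)) using 1
  ext x
  simp

theorem continuous_translate (g : SL(m, ℝ)) : Continuous (translate (m := m) g) := by
  refine continuous_of_isClosed_graph ?_
  have hgraph : {p : VisualSphere m × VisualSphere m | translate g p.1 = p.2} =
      ⋂ (t : ℝ) (_ : 0 ≤ t), {p | ‖((expSL p.2 t)⁻¹ * g * expSL p.1 t).1‖ ≤ ‖g.1‖} := by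
    ext ⟨Z, ξ⟩
    simp only [Set.mem_iInter, Set.mem_ofPred_eq]
    refine ⟨?_, fun h => rayAsymptotic_iff_translate_eq.mp ⟨_, h⟩⟩
    rintro rfl t ht
    exact norm_translate_le g Z ht
  rw [hgraph]
  refine isClosed_iInter fun t => isClosed_iInter fun _ => isClosed_le ?_ continuous_const
  exact (continuous_subtype_val.comp ((((continuous_expSL t).comp continuous_snd).inv.mul
    continuous_const).mul ((continuous_expSL t).comp continuous_fst))).norm

/-- The homeomorphism of the visual sphere induced by an element of `SL_m(ℝ)`. -/
def translateHomeo (g : SL(m, ℝ)) : VisualSphere m ≃ₜ VisualSphere m where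
  toFun := translate g
  invFun := translate g⁻¹
  left_inv := translate_inv_translate g
  right_inv Z := by simpa using translate_inv_translate g⁻¹ Z
  continuous_toFun := continuous_translate g
  continuous_invFun := continuous_translate g⁻¹

end Translation

section SphereAtInfinity

open Matrix
open scoped MatrixGroups

variable {m : ℕ} {ι : Type} {U : ι → Submodule ℝ (Fin m → ℝ)} {ξ : VisualSphere m}

theorem mem_sphereAtInfinity_iff : ξ ∈ sphereAtInfinity U ↔
    ∃ (g : SL(m, ℝ)) (Z : VisualSphere m),
      (∀ t : ℝ, 0 ≤ t → geodesic g Z t ∈ symSubspace U) ∧ RayAsymptotic g Z ξ := by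
  simp only [sphereAtInfinity, boundaryAtInfinity, Set.mem_ofPred_eq, asymptotic_geodesic_iff]

theorem innerAt_mk (a : SL(m, ℝ)) (u v : Fin m → ℝ) :
    innerAt (QuotientGroup.mk a : SymSpace m) u v = ((a⁻¹).1 *ᵥ u) ⬝ᵥ ((a⁻¹).1 *ᵥ v) := by
  rw [innerAt, inv_gram_mk, ← mulVec_mulVec, dotProduct_mulVec, vecMul_transpose]

theorem mul_mem_symSubspace_map_iff {g a : SL(m, ℝ)} :
    (QuotientGroup.mk (g * a) : SymSpace m) ∈ symSubspace (fun i => (U i).map (mulVecLin g.1)) ↔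
      (QuotientGroup.mk a : SymSpace m) ∈ symSubspace U := by
  have hcancel : ∀ u, ((g * a)⁻¹).1 *ᵥ (g.1 *ᵥ u) = (a⁻¹).1 *ᵥ u := fun u => by
    rw [mulVec_mulVec]
    exact congrArg (fun b : SL(m, ℝ) => b.1 *ᵥ u) (by group : (g * a)⁻¹ * g = a⁻¹)
  simp only [symSubspace, Set.mem_ofPred_eq, innerAt_mk, Submodule.mem_map, mulVecLin_apply,
    forall_exists_index, and_imp, forall_apply_eq_imp_iff₂, hcancel]

theorem sphereAtInfinity_map (U : ι → Submodule ℝ (Fin m → ℝ)) (g : SL(m, ℝ)) :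
    sphereAtInfinity (fun i => (U i).map (mulVecLin g.1)) =
      translateHomeo g '' sphereAtInfinity U := by
  ext ξ
  rw [Homeomorph.image_eq_preimage_symm, Set.mem_preimage, mem_sphereAtInfinity_iff,
    mem_sphereAtInfinity_iff]
  have hξ : RayAsymptotic g⁻¹ ξ ((translateHomeo g).symm ξ) :=
    rayAsymptotic_iff_translate_eq.mpr rfl
  constructor
  · rintro ⟨a, Z, ha, hZ⟩
    refine ⟨g⁻¹ * a, Z, fun t ht => ?_, hZ.trans hξ⟩
    rw [geodesic, ← mul_mem_symSubspace_map_iff (g := g), ← mul_assoc, mul_inv_cancel_left]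
    exact ha t ht
  · rintro ⟨a, Z, ha, hZ⟩
    refine ⟨g * a, Z, fun t ht => ?_, by simpa using hZ.trans hξ.inv⟩
    rw [geodesic, mul_assoc, mul_mem_symSubspace_map_iff]
    exact ha t ht

end SphereAtInfinity

section OrthogonalDecompositions

open Matrix
open scoped MatrixGroups

variable {m : ℕ} {U V : Submodule ℝ (Fin m → ℝ)} {p : SymSpace m} {l φ v : Fin m → ℝ}
  {ξ : VisualSphere m}

theorem innerAt_comm (p : SymSpace m) (u v : Fin m → ℝ) : innerAt p u v = innerAt p v u := by
  induction p using QuotientGroup.induction_on with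
  | H a => rw [innerAt_mk, innerAt_mk, dotProduct_comm]

theorem innerAt_smul_left (p : SymSpace m) (c : ℝ) (u v : Fin m → ℝ) :
    innerAt p (c • u) v = c * innerAt p u v := by
  rw [innerAt, innerAt, smul_dotProduct, smul_eq_mul]

theorem innerAt_smul_right (p : SymSpace m) (c : ℝ) (u v : Fin m → ℝ) :
    innerAt p u (c • v) = c * innerAt p u v := by
  rw [innerAt_comm, innerAt_smul_left, innerAt_comm]

theorem innerAt_sum_right {ι : Type*} (s : Finset ι) (p : SymSpace m) (u : Fin m → ℝ)
    (v : ι → Fin m → ℝ) : innerAt p u (∑ i ∈ s, v i) = ∑ i ∈ s, innerAt p u (v i) := by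
  simp only [innerAt, mulVec_sum, dotProduct_sum]

theorem mem_symSubspace_pair_iff :
    p ∈ symSubspace ![U, V] ↔ ∀ u ∈ U, ∀ v ∈ V, innerAt p u v = 0 := by
  refine ⟨fun h => h zero_ne_one, fun h i j hij => ?_⟩
  fin_cases i <;> fin_cases j
  · exact absurd rfl hij
  · exact h
  · exact fun u hu v hv => (innerAt_comm p u v).trans (h v hv u hu)
  · exact absurd rfl hij

theorem mem_symSubspace_span_singleton_iff :
    p ∈ symSubspace ![ℝ ∙ l, V] ↔ ∀ v ∈ V, innerAt p l v = 0 := by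
  refine mem_symSubspace_pair_iff.trans
    ⟨fun h => h l (Submodule.mem_span_singleton_self l), fun h u hu v hv => ?_⟩
  obtain ⟨c, rfl⟩ := Submodule.mem_span_singleton.mp hu
  rw [innerAt_smul_left, h v hv, mul_zero]

/-- The hyperplane `φ^⊥`, with respect to the inner product of the base point. -/
def orthHyperplane (φ : Fin m → ℝ) : Submodule ℝ (Fin m → ℝ) :=
  LinearMap.ker (dotProductBilin ℝ ℝ φ)

theorem mem_orthHyperplane : v ∈ orthHyperplane φ ↔ φ ⬝ᵥ v = 0 :=
  Iff.rfl

theorem orthHyperplane_neg (φ : Fin m → ℝ) : orthHyperplane (-φ) = orthHyperplane φ := by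
  ext v
  rw [mem_orthHyperplane, mem_orthHyperplane, neg_dotProduct, neg_eq_zero]

theorem exists_eq_smul_of_forall_mem_orthHyperplane {w : Fin m → ℝ} (hφ : φ ≠ 0)
    (h : ∀ v ∈ orthHyperplane φ, w ⬝ᵥ v = 0) : ∃ c : ℝ, w = c • φ := by
  have hφφ : φ ⬝ᵥ φ ≠ 0 := dotProduct_self_eq_zero.not.mpr hφ
  refine ⟨(φ ⬝ᵥ w) / (φ ⬝ᵥ φ), sub_eq_zero.mp (dotProduct_self_eq_zero.mp ?_)⟩
  have hmem : φ ⬝ᵥ (w - ((φ ⬝ᵥ w) / (φ ⬝ᵥ φ)) • φ) = 0 := by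
    rw [dotProduct_sub, dotProduct_smul, smul_eq_mul, div_mul_cancel₀ _ hφφ, sub_self]
  rw [sub_dotProduct, h _ hmem, smul_dotProduct, hmem, smul_zero, sub_zero]

theorem exists_inv_mulVec_eq_smul {a : SL(m, ℝ)} (hφ : φ ≠ 0)
    (h : (QuotientGroup.mk a : SymSpace m) ∈ symSubspace ![ℝ ∙ l, orthHyperplane φ]) :
    ∃ c : ℝ, (a⁻¹).1 *ᵥ l = c • a.1ᵀ *ᵥ φ := by
  obtain ⟨c, hc⟩ := exists_eq_smul_of_forall_mem_orthHyperplane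
    (w := (a⁻¹).1ᵀ *ᵥ ((a⁻¹).1 *ᵥ l)) hφ fun v hv => by
      rw [mulVec_transpose, ← dotProduct_mulVec, ← innerAt_mk]
      exact mem_symSubspace_span_singleton_iff.mp h v hv
  refine ⟨c, ?_⟩
  rw [← mulVec_smul, ← hc, mulVec_mulVec, ← transpose_mul, coe_inv_mul_coe, transpose_one,
    one_mulVec]

theorem exists_exp_mulVec_eq_smul_of_geodesic_mem {g : SL(m, ℝ)} {Z : VisualSphere m} {t : ℝ}
    (hφ : φ ≠ 0) (h : geodesic g Z t ∈ symSubspace ![ℝ ∙ l, orthHyperplane φ]) :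
    ∃ c : ℝ, NormedSpace.exp ((-(2 * t)) • Z.1) *ᵥ ((g⁻¹).1 *ᵥ l) = c • g.1ᵀ *ᵥ φ := by
  obtain ⟨c, hc⟩ := exists_inv_mulVec_eq_smul hφ h
  refine ⟨c, ?_⟩
  have hinv : ((g * expSL Z t)⁻¹).1 = (expSL Z (-t)).1 * (g⁻¹).1 :=
    congrArg Subtype.val (show (g * expSL Z t)⁻¹ = expSL Z (-t) * g⁻¹ by
      rw [_root_.mul_inv_rev, inv_expSL])
  have htranspose : (g * expSL Z t).1ᵀ = (expSL Z t).1 * g.1ᵀ := by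
    rw [← transpose_expSL, ← transpose_mul]
    rfl
  have hcancel : (expSL Z (-t)).1 * (expSL Z t).1 = 1 := by
    rw [← inv_expSL, coe_inv_mul_coe]
  have hsq : NormedSpace.exp ((-(2 * t)) • Z.1) = (expSL Z (-t)).1 * (expSL Z (-t)).1 := by
    rw [coe_expSL, ← Matrix.exp_add_of_commute _ _ (Commute.refl _), ← add_smul]
    ring_nf
  rw [hinv, htranspose, ← mulVec_mulVec, ← mulVec_mulVec] at hc
  rw [hsq, ← mulVec_mulVec, hc, mulVec_smul, mulVec_mulVec, hcancel, one_mulVec]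

/-- Along the ray, `exp(-tZ) g⁻¹ l` stays proportional to `exp(tZ) gᵀ φ`; comparing two times shows
that `g⁻¹ l` is an eigenvector of `Z`, and `gᵀ φ` is one for the same eigenvalue. -/
theorem exists_mulVec_eq_smul_of_geodesic_mem {g : SL(m, ℝ)} {Z : VisualSphere m} (hl : l ≠ 0)
    (hφ : φ ≠ 0)
    (h : ∀ t : ℝ, 0 ≤ t → geodesic g Z t ∈ symSubspace ![ℝ ∙ l, orthHyperplane φ]) :
    ∃ c : ℝ, Z.1 *ᵥ ((g⁻¹).1 *ᵥ l) = c • (g⁻¹).1 *ᵥ l ∧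
      Z.1 *ᵥ (g.1ᵀ *ᵥ φ) = c • g.1ᵀ *ᵥ φ := by
  obtain ⟨c₀, hc₀⟩ := exists_exp_mulVec_eq_smul_of_geodesic_mem hφ (h 0 le_rfl)
  rw [mul_zero, neg_zero, zero_smul, NormedSpace.exp_zero, one_mulVec] at hc₀
  have hc₀_ne : c₀ ≠ 0 := fun h0 => hl <| by
    rw [← one_mulVec l, ← coe_mul_coe_inv g, ← mulVec_mulVec, hc₀, h0, zero_smul, mulVec_zero]
  have hφ_eq : g.1ᵀ *ᵥ φ = c₀⁻¹ • (g⁻¹).1 *ᵥ l := by rw [hc₀, inv_smul_smul₀ hc₀_ne]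
  obtain ⟨c₁, hc₁⟩ := exists_exp_mulVec_eq_smul_of_geodesic_mem hφ (h (1 / 2) (by norm_num))
  rw [hφ_eq, smul_smul, mul_one_div_cancel two_ne_zero, neg_one_smul] at hc₁
  obtain ⟨c, hc⟩ := exists_mulVec_eq_smul_of_exp Z.2.1.neg hc₁
  have hZ : Z.1 *ᵥ ((g⁻¹).1 *ᵥ l) = -c • (g⁻¹).1 *ᵥ l := by
    rw [neg_smul, ← hc, neg_mulVec, neg_neg]
  exact ⟨-c, hZ, by rw [hφ_eq, mulVec_smul, hZ, smul_comm]⟩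

theorem exists_rayleigh_bounds_of_mem_sphereAtInfinity (hl : l ≠ 0) (hφ : φ ≠ 0)
    (h : ξ ∈ sphereAtInfinity ![ℝ ∙ l, orthHyperplane φ]) :
    ∃ c : ℝ, c * (l ⬝ᵥ l) ≤ l ⬝ᵥ ξ.1 *ᵥ l ∧ φ ⬝ᵥ ξ.1 *ᵥ φ ≤ c * (φ ⬝ᵥ φ) ∧
      (l ⬝ᵥ ξ.1 *ᵥ l = c * (l ⬝ᵥ l) → ξ.1 *ᵥ l = c • l) := by
  obtain ⟨g, Z, hgeod, hasymp⟩ := mem_sphereAtInfinity_iff.mp h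
  obtain ⟨c, hcl, hcφ⟩ := exists_mulVec_eq_smul_of_geodesic_mem hl hφ hgeod
  have hgl : g.1 *ᵥ ((g⁻¹).1 *ᵥ l) = l := by rw [mulVec_mulVec, coe_mul_coe_inv, one_mulVec]
  have hlower := hasymp.le_rayleigh hcl
  rw [hgl] at hlower
  exact ⟨c, hlower.1, (hasymp.rayleigh_le hcφ).1, hlower.2⟩

theorem innerAt_geodesic_one_of_mulVec_eq_smul {c : ℝ} (hl : ξ.1 *ᵥ l = c • l)
    (v : Fin m → ℝ) (t : ℝ) : innerAt (geodesic 1 ξ t) l v = Real.exp (-t * c) ^ 2 * (l ⬝ᵥ v) := by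
  have hexp : (expSL ξ (-t)).1 *ᵥ l = Real.exp (-t * c) • l :=
    exp_smul_mulVec_of_mulVec_eq_smul ξ.2.1 hl _
  rw [geodesic, one_mul, innerAt_mk, inv_expSL, hexp, smul_dotProduct, dotProduct_mulVec,
    ← mulVec_transpose, transpose_expSL, hexp, smul_dotProduct, smul_smul, smul_eq_mul, sq]

theorem geodesic_one_mem_symSubspace {c : ℝ} (hl : ξ.1 *ᵥ l = c • l) (t : ℝ) :
    geodesic 1 ξ t ∈ symSubspace ![ℝ ∙ l, orthHyperplane l] :=
  mem_symSubspace_span_singleton_iff.mpr fun v hv => by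
    rw [innerAt_geodesic_one_of_mulVec_eq_smul hl, mem_orthHyperplane.mp hv, mul_zero]

theorem mem_sphereAtInfinity_of_geodesic_one_mem {ι : Type} {W : ι → Submodule ℝ (Fin m → ℝ)}
    (h : ∀ t : ℝ, 0 ≤ t → geodesic 1 ξ t ∈ symSubspace W) : ξ ∈ sphereAtInfinity W :=
  mem_sphereAtInfinity_iff.mpr ⟨1, ξ, h, RayAsymptotic.refl ξ⟩

theorem mem_sphereAtInfinity_orthHyperplane_self_iff (hl : l ≠ 0) :
    ξ ∈ sphereAtInfinity ![ℝ ∙ l, orthHyperplane l] ↔ ∃ c : ℝ, ξ.1 *ᵥ l = c • l := by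
  constructor
  · intro h
    obtain ⟨c, hlower, hupper, heq⟩ := exists_rayleigh_bounds_of_mem_sphereAtInfinity hl hl h
    exact ⟨c, heq (hupper.antisymm hlower)⟩
  · rintro ⟨c, hc⟩
    exact mem_sphereAtInfinity_of_geodesic_one_mem fun t _ => geodesic_one_mem_symSubspace hc t

/-- The coordinate axes. -/
def axis (i : Fin m) : Submodule ℝ (Fin m → ℝ) :=
  ℝ ∙ Pi.single i 1

theorem mem_symSubspace_axis_iff : p ∈ symSubspace axis ↔
    ∀ j, p ∈ symSubspace ![ℝ ∙ (Pi.single j 1 : Fin m → ℝ), orthHyperplane (Pi.single j 1)] := by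
  simp only [mem_symSubspace_span_singleton_iff]
  constructor
  · intro h j v hv
    rw [pi_eq_sum_univ' v, innerAt_sum_right]
    refine Finset.sum_eq_zero fun i _ => ?_
    rw [innerAt_smul_right]
    rcases eq_or_ne j i with rfl | hji
    · rw [mem_orthHyperplane, single_one_dotProduct] at hv
      rw [hv, zero_mul]
    · rw [h hji _ (Submodule.mem_span_singleton_self _) _ (Submodule.mem_span_singleton_self _),
        mul_zero]
  · intro h i j hij
    refine mem_symSubspace_pair_iff.mp (mem_symSubspace_span_singleton_iff.mpr fun v hv => ?_)
    obtain ⟨c, rfl⟩ := Submodule.mem_span_singleton.mp hv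
    exact h i _ (by simp [mem_orthHyperplane, hij])

theorem isDiag_iff_forall_exists_mulVec_single {n : Type*} [Fintype n] [DecidableEq n]
    {M : Matrix n n ℝ} :
    M.IsDiag ↔ ∀ j, ∃ c : ℝ, M *ᵥ Pi.single j 1 = c • (Pi.single j 1 : n → ℝ) := by
  constructor
  · intro h j
    refine ⟨M j j, funext fun i => ?_⟩
    rcases eq_or_ne i j with rfl | hij
    · simp
    · simp [hij, h hij]
  · intro h i j hij
    obtain ⟨c, hc⟩ := h j
    simpa [hij] using congrFun hc i

theorem mem_sphereAtInfinity_axis_iff : ξ ∈ sphereAtInfinity axis ↔ ξ.1.IsDiag := by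
  have hsingle : ∀ j : Fin m, (Pi.single j 1 : Fin m → ℝ) ≠ 0 := by simp
  rw [isDiag_iff_forall_exists_mulVec_single]
  constructor
  · rintro ⟨g, Z, hgeod, hasymp⟩ j
    rw [← mem_sphereAtInfinity_orthHyperplane_self_iff (hsingle j)]
    exact ⟨g, Z, fun t ht => mem_symSubspace_axis_iff.mp (hgeod t ht) j, hasymp⟩
  · intro h
    choose c hc using h
    exact mem_sphereAtInfinity_of_geodesic_one_mem fun t _ =>
      mem_symSubspace_axis_iff.mpr fun j => geodesic_one_mem_symSubspace (hc j) t

end OrthogonalDecompositions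

/-- All the numbers `a i` are positive or all of them are negative. -/
def HasConstantSign {ι : Type*} (a : ι → ℝ) : Prop :=
  (∀ i, 0 < a i) ∨ ∀ i, a i < 0

theorem hasConstantSign_mul_iff {ι : Type*} {l φ : ι → ℝ} (hl : ∀ i, l i ≠ 0)
    (habs : ∀ i, |φ i| = |l i|) : HasConstantSign (φ * l) ↔ φ = l ∨ φ = -l := by
  have hpos : ∀ i, 0 < l i * l i := fun i => mul_self_pos.mpr (hl i)
  constructor
  · rintro (h | h)
    · refine Or.inl (funext fun i => (abs_eq_abs.mp (habs i)).resolve_right fun hi => ?_)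
      have := h i
      rw [Pi.mul_apply, hi, neg_mul] at this
      linarith [hpos i]
    · refine Or.inr (funext fun i => (abs_eq_abs.mp (habs i)).resolve_left fun hi => ?_)
      have := h i
      rw [Pi.mul_apply, hi] at this
      exact lt_asymm this (hpos i)
  · rintro (rfl | rfl)
    · exact Or.inl hpos
    · exact Or.inr fun i => by simpa using hpos i

section AdaptedBasePoint

open Matrix

variable {m : ℕ} {l φ : Fin m → ℝ} {ξ : VisualSphere m}

/-- The difference `φᵀ M φ - lᵀ M l` of the values of a quadratic form, as a functional of `M`. -/
def quadDiff (φ l : Fin m → ℝ) : Matrix (Fin m) (Fin m) ℝ →ₗ[ℝ] ℝ where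
  toFun M := φ ⬝ᵥ M *ᵥ φ - l ⬝ᵥ M *ᵥ l
  map_add' M N := by
    simp only [add_mulVec, dotProduct_add]
    ring
  map_smul' c M := by
    simp only [smul_mulVec, dotProduct_smul, smul_eq_mul, RingHom.id_apply]
    ring

theorem quadDiff_apply (φ l : Fin m → ℝ) (M : Matrix (Fin m) (Fin m) ℝ) :
    quadDiff φ l M = φ ⬝ᵥ M *ᵥ φ - l ⬝ᵥ M *ᵥ l :=
  rfl

theorem dotProduct_self_eq_of_abs_eq (habs : ∀ i, |φ i| = |l i|) : φ ⬝ᵥ φ = l ⬝ᵥ l :=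
  Finset.sum_congr rfl fun i _ => by rw [← abs_mul_abs_self, habs, abs_mul_abs_self]

theorem quadDiff_eq_zero_of_isDiag (habs : ∀ i, |φ i| = |l i|) {M : Matrix (Fin m) (Fin m) ℝ}
    (hM : M.IsDiag) : quadDiff φ l M = 0 := by
  rw [quadDiff_apply, ← hM.diagonal_diag, sub_eq_zero]
  simp only [dotProduct, mulVec_diagonal]
  refine Finset.sum_congr rfl fun i _ => ?_
  have hsq : φ i * φ i = l i * l i := by rw [← abs_mul_abs_self, habs, abs_mul_abs_self]
  linear_combination M.diag i * hsq

/-- By strict Cauchy-Schwarz, since the value at `φφᵀ - llᵀ` is `2 ((l ⬝ l)² - (l ⬝ φ)²)`. -/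
theorem exists_quadDiff_pos (habs : ∀ i, |φ i| = |l i|) (h : ¬(φ = l ∨ φ = -l)) :
    ∃ Y ∈ symTraceless m, 0 < quadDiff φ l Y := by
  rw [not_or] at h
  have hsq := dotProduct_self_eq_of_abs_eq habs
  have hsub := dotProduct_self_star_pos_iff.mpr (sub_ne_zero.mpr h.1)
  have hadd_ne : φ + l ≠ 0 := mt eq_neg_of_add_eq_zero_left h.2
  have hadd := dotProduct_self_star_pos_iff.mpr hadd_ne
  simp only [star_trivial, sub_dotProduct, dotProduct_sub, add_dotProduct,
    dotProduct_add, dotProduct_comm l φ] at hsub hadd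
  refine ⟨vecMulVec φ φ - vecMulVec l l, ⟨?_, ?_⟩, ?_⟩
  · rw [IsSymm, transpose_sub, transpose_vecMulVec, transpose_vecMulVec]
  · rw [trace_sub, trace_vecMulVec, trace_vecMulVec, hsq, sub_self]
  · simp only [quadDiff_apply, sub_mulVec, vecMulVec_mulVec, dotProduct_sub, op_smul_eq_smul,
      dotProduct_smul, smul_eq_mul, dotProduct_comm l φ, hsq]
    nlinarith

theorem orthHyperplane_eq (h : φ = l ∨ φ = -l) : orthHyperplane φ = orthHyperplane l := by
  rcases h with rfl | rfl
  · rfl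
  · exact orthHyperplane_neg l

/-- The traceless diagonal matrix with entries `(Z l)_i / l_i`, up to a multiple of the identity.
When no `l_i` vanishes it is a projection onto the traceless diagonal matrices, whose kernel
consists of the matrices with eigenvector `l`. -/
def diagProjection (l : Fin m → ℝ) : Matrix (Fin m) (Fin m) ℝ →ₗ[ℝ] Matrix (Fin m) (Fin m) ℝ where
  toFun Z := diagonal fun i => (Z *ᵥ l) i / l i - (∑ j, (Z *ᵥ l) j / l j) / m
  map_add' Z W := by
    rw [diagonal_add]
    congr 1
    funext i
    simp only [add_mulVec, Pi.add_apply, add_div, Finset.sum_add_distrib]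
    ring
  map_smul' c Z := by
    rw [RingHom.id_apply, ← diagonal_smul]
    congr 1
    funext i
    simp only [smul_mulVec, Pi.smul_apply, smul_eq_mul, mul_div_assoc, ← Finset.mul_sum]
    ring

theorem diagProjection_apply (l : Fin m → ℝ) (Z : Matrix (Fin m) (Fin m) ℝ) :
    diagProjection l Z =
      diagonal fun i => (Z *ᵥ l) i / l i - (∑ j, (Z *ᵥ l) j / l j) / m :=
  rfl

theorem diagProjection_eq_self (hl : ∀ i, l i ≠ 0) {Z : Matrix (Fin m) (Fin m) ℝ} (hZ : Z.IsDiag)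
    (htr : Z.trace = 0) : diagProjection l Z = Z := by
  have hquot : ∀ i, (Z *ᵥ l) i / l i = Z.diag i := fun i => by
    conv_lhs => rw [← hZ.diagonal_diag, mulVec_diagonal, mul_div_cancel_right₀ _ (hl i)]
  have hsum : ∑ i, Z.diag i = 0 := htr
  simp only [diagProjection_apply, hquot, hsum, zero_div, sub_zero]
  exact hZ.diagonal_diag

theorem sphereAtInfinity_axis_eq (hl : ∀ i, l i ≠ 0) :
    sphereAtInfinity axis = {Z : VisualSphere m | diagProjection l Z.1 = Z.1} := by
  ext Z
  rw [mem_sphereAtInfinity_axis_iff]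
  refine ⟨fun h => diagProjection_eq_self hl h Z.2.2.1, fun h => ?_⟩
  rw [← show diagProjection l Z.1 = Z.1 from h]
  exact isDiag_diagonal _

variable [NeZero m]

theorem diagProjection_mem_symTraceless (l : Fin m → ℝ) (Z : Matrix (Fin m) (Fin m) ℝ) :
    diagProjection l Z ∈ symTraceless m := by
  refine ⟨isSymm_diagonal _, ?_⟩
  rw [diagProjection_apply, trace_diagonal, Finset.sum_sub_distrib, Finset.sum_const,
    Finset.card_univ, Fintype.card_fin, nsmul_eq_mul,
    mul_div_cancel₀ _ (NeZero.ne (m : ℝ)), sub_self]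

theorem diagProjection_diagProjection (hl : ∀ i, l i ≠ 0) (Z : Matrix (Fin m) (Fin m) ℝ) :
    diagProjection l (diagProjection l Z) = diagProjection l Z :=
  diagProjection_eq_self hl (isDiag_diagonal _) (diagProjection_mem_symTraceless l Z).2

theorem diagProjection_eq_zero_iff (hl : ∀ i, l i ≠ 0) {Z : Matrix (Fin m) (Fin m) ℝ} :
    diagProjection l Z = 0 ↔ ∃ c : ℝ, Z *ᵥ l = c • l := by
  rw [diagProjection_apply, diagonal_eq_zero]
  constructor
  · intro h
    refine ⟨(∑ j, (Z *ᵥ l) j / l j) / m, funext fun i => ?_⟩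
    rw [Pi.smul_apply, smul_eq_mul, ← sub_eq_zero.mp (congrFun h i), div_mul_cancel₀ _ (hl i)]
  · rintro ⟨c, hc⟩
    have hquot : ∀ i, (c • l) i / l i = c := fun i => by
      rw [Pi.smul_apply, smul_eq_mul, mul_div_cancel_right₀ _ (hl i)]
    funext i
    simp only [hc, hquot, Finset.sum_const, Finset.card_univ, Fintype.card_fin, nsmul_eq_mul,
      mul_div_cancel_left₀ _ (NeZero.ne (m : ℝ)), sub_self, Pi.zero_apply]

theorem sphereAtInfinity_orthHyperplane_self_eq (hl : ∀ i, l i ≠ 0) :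
    sphereAtInfinity ![ℝ ∙ l, orthHyperplane l] =
      {Z : VisualSphere m | diagProjection l Z.1 = 0} := by
  ext Z
  rw [mem_sphereAtInfinity_orthHyperplane_self_iff (Function.ne_iff.mpr ⟨0, hl 0⟩)]
  exact (diagProjection_eq_zero_iff hl).symm

theorem not_contractsIn_axis (hl : ∀ i, l i ≠ 0) :
    ¬ContractsIn (sphereAtInfinity axis) (sphereAtInfinity ![ℝ ∙ l, orthHyperplane l])ᶜ := by
  rw [sphereAtInfinity_axis_eq hl, sphereAtInfinity_orthHyperplane_self_eq hl]
  exact VisualSphere.not_contractsIn_of_idempotent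
    (fun Z _ => diagProjection_mem_symTraceless l Z) (diagProjection_diagProjection hl)

theorem not_contractsIn_orthHyperplane_self (hl : ∀ i, l i ≠ 0) :
    ¬ContractsIn (sphereAtInfinity ![ℝ ∙ l, orthHyperplane l]) (sphereAtInfinity axis)ᶜ := by
  have hcompl := VisualSphere.not_contractsIn_of_idempotent (p := LinearMap.id - diagProjection l)
    (fun Z hZ => sub_mem hZ (diagProjection_mem_symTraceless l Z)) fun Z => by
      simp only [LinearMap.sub_apply, LinearMap.id_apply, map_sub,
        diagProjection_diagProjection hl, sub_self, sub_zero]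
  simp only [LinearMap.sub_apply, LinearMap.id_apply, sub_eq_self, sub_eq_zero] at hcompl
  simpa only [sphereAtInfinity_axis_eq hl, sphereAtInfinity_orthHyperplane_self_eq hl,
    eq_comm (b := diagProjection l _)] using hcompl

theorem ne_zero_of_abs_eq (hl : ∀ i, l i ≠ 0) (habs : ∀ i, |φ i| = |l i|) : φ ≠ 0 :=
  Function.ne_iff.mpr ⟨0, abs_ne_zero.mp (habs 0 ▸ abs_ne_zero.mpr (hl 0))⟩

theorem quadDiff_nonpos_of_mem_sphereAtInfinity (hl : ∀ i, l i ≠ 0) (habs : ∀ i, |φ i| = |l i|)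
    (h : ξ ∈ sphereAtInfinity ![ℝ ∙ l, orthHyperplane φ]) :
    quadDiff φ l ξ.1 ≤ 0 ∧ (quadDiff φ l ξ.1 = 0 → ∃ c : ℝ, ξ.1 *ᵥ l = c • l) := by
  obtain ⟨c, hlower, hupper, heq⟩ := exists_rayleigh_bounds_of_mem_sphereAtInfinity
    (Function.ne_iff.mpr ⟨0, hl 0⟩) (ne_zero_of_abs_eq hl habs) h
  rw [dotProduct_self_eq_of_abs_eq habs] at hupper
  rw [quadDiff_apply]
  exact ⟨by linarith, fun h0 => ⟨c, heq (by linarith)⟩⟩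

theorem disjoint_sphereAtInfinity_axis (hl : ∀ i, l i ≠ 0) (habs : ∀ i, |φ i| = |l i|) :
    Disjoint (sphereAtInfinity axis) (sphereAtInfinity ![ℝ ∙ l, orthHyperplane φ]) := by
  refine Set.disjoint_left.mpr fun Z hA hB => ?_
  have heigen := (quadDiff_nonpos_of_mem_sphereAtInfinity hl habs hB).2
    (quadDiff_eq_zero_of_isDiag habs (mem_sphereAtInfinity_axis_iff.mp hA))
  rw [sphereAtInfinity_axis_eq hl, Set.mem_ofPred_eq,
    (diagProjection_eq_zero_iff hl).mpr heigen] at hA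
  have hnorm := Z.2.2.2
  simp [← hA] at hnorm

theorem contractsIn_axis (hl : ∀ i, l i ≠ 0) (habs : ∀ i, |φ i| = |l i|)
    (h : ¬(φ = l ∨ φ = -l)) :
    ContractsIn (sphereAtInfinity axis) (sphereAtInfinity ![ℝ ∙ l, orthHyperplane φ])ᶜ := by
  obtain ⟨Y, hY, hpos⟩ := exists_quadDiff_pos habs h
  exact VisualSphere.contractsIn_compl_of_functional (disjoint_sphereAtInfinity_axis hl habs)
    (quadDiff φ l)
    (fun Z hZ => (quadDiff_eq_zero_of_isDiag habs (mem_sphereAtInfinity_axis_iff.mp hZ)).ge)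
    (fun Z hZ => (quadDiff_nonpos_of_mem_sphereAtInfinity hl habs hZ).1) hY hpos

theorem contractsIn_orthHyperplane (hl : ∀ i, l i ≠ 0) (habs : ∀ i, |φ i| = |l i|)
    (h : ¬(φ = l ∨ φ = -l)) :
    ContractsIn (sphereAtInfinity ![ℝ ∙ l, orthHyperplane φ]) (sphereAtInfinity axis)ᶜ := by
  obtain ⟨Y, hY, hpos⟩ := exists_quadDiff_pos habs h
  exact VisualSphere.contractsIn_compl_of_functional (disjoint_sphereAtInfinity_axis hl habs).symm
    (-quadDiff φ l)
    (fun Z hZ => neg_nonneg.mpr (quadDiff_nonpos_of_mem_sphereAtInfinity hl habs hZ).1)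
    (fun Z hZ => (neg_eq_zero.mpr
      (quadDiff_eq_zero_of_isDiag habs (mem_sphereAtInfinity_axis_iff.mp hZ))).le)
    (neg_mem hY) (by rwa [LinearMap.neg_apply, map_neg, neg_neg])

theorem links_axis_iff (hl : ∀ i, l i ≠ 0) (habs : ∀ i, |φ i| = |l i|) :
    Links (sphereAtInfinity axis) (sphereAtInfinity ![ℝ ∙ l, orthHyperplane φ]) ↔
      HasConstantSign (φ * l) := by
  rw [hasConstantSign_mul_iff hl habs]
  refine ⟨fun h => by_contra fun hne => h.2 (contractsIn_axis hl habs hne),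
    fun h => ⟨disjoint_sphereAtInfinity_axis hl habs, ?_⟩⟩
  rw [orthHyperplane_eq h]
  exact not_contractsIn_axis hl

theorem links_orthHyperplane_iff (hl : ∀ i, l i ≠ 0) (habs : ∀ i, |φ i| = |l i|) :
    Links (sphereAtInfinity ![ℝ ∙ l, orthHyperplane φ]) (sphereAtInfinity axis) ↔
      HasConstantSign (φ * l) := by
  rw [hasConstantSign_mul_iff hl habs]
  refine ⟨fun h => by_contra fun hne => h.2 (contractsIn_orthHyperplane hl habs hne),
    fun h => ⟨(disjoint_sphereAtInfinity_axis hl habs).symm, ?_⟩⟩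
  rw [orthHyperplane_eq h]
  exact not_contractsIn_orthHyperplane_self hl

end AdaptedBasePoint

section Signs

open Matrix

variable {ι : Type*} {a : ι → ℝ}

theorem hasConstantSign_smul_iff {c : ℝ} (hc : c ≠ 0) :
    HasConstantSign (c • a) ↔ HasConstantSign a := by
  simp only [HasConstantSign, Pi.smul_apply, smul_eq_mul]
  rcases hc.lt_or_gt with hneg | hpos
  · simp only [mul_pos_iff, mul_neg_iff, hneg, hneg.not_gt, true_and, false_and, false_or]
    exact or_comm
  · simp only [mul_pos_iff, mul_neg_iff, hpos, hpos.not_gt, true_and, false_and, or_false]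

variable [Fintype ι] [Nonempty ι]

theorem forall_pos_dotProduct_ne_zero_iff (ha : ∀ i, a i ≠ 0) :
    (∀ c : ι → ℝ, (∀ i, 0 < c i) → c ⬝ᵥ a ≠ 0) ↔ HasConstantSign a := by
  classical
  constructor
  · intro h
    by_contra hsign
    simp only [HasConstantSign, not_or, not_forall, not_lt] at hsign
    obtain ⟨⟨j, hj⟩, i, hi⟩ := hsign
    obtain ⟨k, hk⟩ : ∃ k, (∑ i, a i) / a k ≤ 0 := by
      rcases le_total 0 (∑ i, a i) with hsum | hsum
      · exact ⟨j, div_nonpos_of_nonneg_of_nonpos hsum hj⟩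
      · exact ⟨i, div_nonpos_of_nonpos_of_nonneg hsum hi⟩
    have hsingle : (0 : ι → ℝ) ≤ Pi.single k (-((∑ i, a i) / a k)) :=
      Pi.single_nonneg.mpr (neg_nonneg.mpr hk)
    refine h (1 + Pi.single k (-((∑ i, a i) / a k))) (fun l => ?_) ?_
    · exact add_pos_of_pos_of_nonneg zero_lt_one (hsingle l)
    · rw [add_dotProduct, one_dotProduct, single_dotProduct, neg_mul, div_mul_cancel₀ _ (ha k),
        add_neg_cancel]
  · rintro (h | h) c hc
    · exact (Finset.sum_pos (fun i _ => mul_pos (hc i) (h i)) Finset.univ_nonempty).ne'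
    · exact (Finset.sum_neg (fun i _ => mul_neg_of_pos_of_neg (hc i) (h i))
        Finset.univ_nonempty).ne

theorem exists_sq_eq_prod_eq (ι : Type*) [Fintype ι] [Nonempty ι] {d : ℝ} (hd : d ≠ 0) :
    ∃ κ > 0, ∃ s : ι → ℝ, (∀ i, s i ^ 2 = κ) ∧ ∏ i, s i = d := by
  classical
  obtain ⟨i₀⟩ := ‹Nonempty ι›
  set ρ := |d| ^ ((Fintype.card ι : ℝ)⁻¹)
  have hρ_pow : ρ ^ Fintype.card ι = |d| :=
    Real.rpow_inv_natCast_pow (abs_nonneg d) (Fintype.card_pos_iff.mpr ⟨i₀⟩).ne'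
  have hsign : (SignType.sign d : ℝ) ^ 2 = 1 := by
    rcases hd.lt_or_gt with h | h <;> simp [h]
  refine ⟨ρ ^ 2, pow_pos (Real.rpow_pos_of_pos (abs_pos.mpr hd) _) 2,
    fun i => ρ * if i = i₀ then (SignType.sign d : ℝ) else 1, fun i => ?_, ?_⟩
  · beta_reduce
    split_ifs
    · rw [mul_pow, hsign, mul_one]
    · rw [mul_one]
  · rw [Finset.prod_mul_distrib, Finset.prod_const, Finset.card_univ, hρ_pow, Finset.prod_ite_eq',
      if_pos (Finset.mem_univ _), abs_mul_sign]

end Signs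

section AdaptedTranslates

open Matrix
open scoped MatrixGroups

variable {m : ℕ} {g : SL(m, ℝ)} {r : Fin m → ℝ} {b : Module.Basis (Fin m) ℝ (Fin m → ℝ)}
  {f : (Fin m → ℝ) →ₗ[ℝ] ℝ}

theorem map_axis_eq (hr : ∀ i, r i ≠ 0) (hg : ∀ u, g.1 *ᵥ u = ∑ i, (u i * r i) • b i)
    (i : Fin m) : (axis i).map (mulVecLin g.1) = ℝ ∙ b i := by
  rw [axis, Submodule.map_span, Set.image_singleton, mulVecLin_apply, hg]
  simp only [Pi.single_apply, ite_mul, one_mul, zero_mul, ite_smul, zero_smul,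
    Finset.sum_ite_eq', Finset.mem_univ, if_true]
  exact Submodule.span_singleton_smul_eq (hr i).isUnit _

theorem map_span_inv_eq (hr : ∀ i, r i ≠ 0) (hg : ∀ u, g.1 *ᵥ u = ∑ i, (u i * r i) • b i) :
    (ℝ ∙ r⁻¹).map (mulVecLin g.1) = ℝ ∙ ∑ i, b i := by
  simp only [Submodule.map_span, Set.image_singleton, mulVecLin_apply, hg, Pi.inv_apply,
    inv_mul_cancel₀ (hr _), one_smul]

theorem map_orthHyperplane_eq {φ : Fin m → ℝ} {κ : ℝ} (hκ : κ ≠ 0)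
    (hf : ∀ u, f (g.1 *ᵥ u) = κ * (φ ⬝ᵥ u)) :
    (orthHyperplane φ).map (mulVecLin g.1) = LinearMap.ker f := by
  ext v
  rw [Submodule.mem_map, LinearMap.mem_ker]
  constructor
  · rintro ⟨u, hu, rfl⟩
    rw [mulVecLin_apply, hf, mem_orthHyperplane.mp hu, mul_zero]
  · intro hv
    have hgv : g.1 *ᵥ ((g⁻¹).1 *ᵥ v) = v := by rw [mulVec_mulVec, coe_mul_coe_inv, one_mulVec]
    rw [← hgv, hf] at hv
    exact ⟨(g⁻¹).1 *ᵥ v, (mul_eq_zero.mp hv).resolve_left hκ, hgv⟩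

variable [NeZero m]

theorem exists_mulVec_eq_sum_smul (b : Module.Basis (Fin m) ℝ (Fin m → ℝ)) {a : Fin m → ℝ}
    (ha : ∀ i, a i ≠ 0) : ∃ (g : SL(m, ℝ)) (r : Fin m → ℝ), ∃ κ > 0,
      (∀ i, r i ^ 2 * |a i| = κ) ∧ ∀ u, g.1 *ᵥ u = ∑ i, (u i * r i) • b i := by
  let W : Matrix (Fin m) (Fin m) ℝ := (of fun i => b i)ᵀ
  have hW : W.det ≠ 0 := ((isUnit_iff_isUnit_det W).mp
    (linearIndependent_cols_iff_isUnit.mp b.linearIndependent)).ne_zero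
  have hsqrt : ∀ i, √|a i| ≠ 0 := fun i => (Real.sqrt_pos.mpr (abs_pos.mpr (ha i))).ne'
  obtain ⟨κ, hκ, s, hs, hprod⟩ := exists_sq_eq_prod_eq (Fin m)
    (mul_ne_zero (inv_ne_zero hW) (Finset.prod_ne_zero_iff.mpr fun i _ => hsqrt i))
  let r : Fin m → ℝ := fun i => s i / √|a i|
  have hdet : (W * diagonal r).det = 1 := by
    rw [det_mul, det_diagonal, Finset.prod_div_distrib, hprod,
      mul_div_cancel_right₀ _ (Finset.prod_ne_zero_iff.mpr fun i _ => hsqrt i),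
      mul_inv_cancel₀ hW]
  refine ⟨⟨W * diagonal r, hdet⟩, r, κ, hκ, fun i => ?_, fun u => ?_⟩
  · rw [div_pow, Real.sq_sqrt (abs_nonneg _), div_mul_cancel₀ _ (abs_ne_zero.mpr (ha i)), hs]
  · have hdiag : diagonal r *ᵥ u = fun i => u i * r i := funext fun i => by
      rw [mulVec_diagonal, mul_comm]
    rw [← mulVec_mulVec, hdiag]
    exact (mulVec_transpose _ _).trans (vecMul_eq_sum _ _)

/-- A volume preserving linear map takes the base point to one at which the frame `b` is orthogonal
and `∑ b i` and `ker f` have coordinate vectors with the same absolute values. -/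
theorem exists_adapted_translate (hf : ∀ i, f (b i) ≠ 0) :
    ∃ (g : SL(m, ℝ)) (l φ : Fin m → ℝ), (∀ i, l i ≠ 0) ∧ (∀ i, |φ i| = |l i|) ∧
      (HasConstantSign (φ * l) ↔ HasConstantSign (f ∘ b)) ∧
      (sphereAtInfinity fun i => ℝ ∙ b i) = translateHomeo g '' sphereAtInfinity axis ∧
      sphereAtInfinity ![ℝ ∙ ∑ i, b i, LinearMap.ker f] =
        translateHomeo g '' sphereAtInfinity ![ℝ ∙ l, orthHyperplane φ] := by
  obtain ⟨g, r, κ, hκ, hr, hg⟩ := exists_mulVec_eq_sum_smul b hf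
  have hr_ne : ∀ i, r i ≠ 0 := fun i hi => hκ.ne' (by rw [← hr i, hi]; ring)
  let φ : Fin m → ℝ := fun i => κ⁻¹ * (r i * f (b i))
  have hφl : φ * r⁻¹ = κ⁻¹ • (f ∘ b) := funext fun i => by
    rw [Pi.mul_apply, Pi.inv_apply, mul_assoc, mul_comm (r i), mul_inv_cancel_right₀ (hr_ne i)]
    rfl
  have habs : ∀ i, |φ i| = |r⁻¹ i| := fun i => by
    rw [Pi.inv_apply, abs_mul, abs_mul, abs_inv, abs_inv, abs_of_pos hκ,
      inv_mul_eq_iff_eq_mul₀ hκ.ne', eq_mul_inv_iff_mul_eq₀ (abs_ne_zero.mpr (hr_ne i)),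
      ← hr i, ← sq_abs (r i)]
    ring
  have hfg : ∀ u, f (g.1 *ᵥ u) = κ * (φ ⬝ᵥ u) := fun u => by
    simp only [hg, map_sum, map_smul, smul_eq_mul, dotProduct, Finset.mul_sum, φ]
    refine Finset.sum_congr rfl fun i _ => ?_
    field_simp
  refine ⟨g, r⁻¹, φ, fun i => inv_ne_zero (hr_ne i), habs, ?_, ?_, ?_⟩
  · rw [hφl, hasConstantSign_smul_iff (inv_ne_zero hκ.ne')]
  · rw [← sphereAtInfinity_map]
    simp only [map_axis_eq hr_ne hg]
  · rw [← sphereAtInfinity_map, ← map_span_inv_eq hr_ne hg, ← map_orthHyperplane_eq hκ.ne' hfg]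
    congr 1
    funext i
    fin_cases i <;> rfl

theorem disjoint_sphereAtInfinity_basis (hf : ∀ i, f (b i) ≠ 0) :
    Disjoint (sphereAtInfinity fun i => ℝ ∙ b i)
      (sphereAtInfinity ![ℝ ∙ ∑ i, b i, LinearMap.ker f]) := by
  obtain ⟨g, l, φ, hl, habs, -, hA, hB⟩ := exists_adapted_translate hf
  rw [hA, hB, Set.disjoint_image_iff (translateHomeo g).injective]
  exact disjoint_sphereAtInfinity_axis hl habs

theorem links_basis_iff (hf : ∀ i, f (b i) ≠ 0) :
    Links (sphereAtInfinity fun i => ℝ ∙ b i)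
        (sphereAtInfinity ![ℝ ∙ ∑ i, b i, LinearMap.ker f]) ↔ HasConstantSign (f ∘ b) := by
  obtain ⟨g, l, φ, hl, habs, hsign, hA, hB⟩ := exists_adapted_translate hf
  rw [hA, hB, links_image_iff, links_axis_iff hl habs, hsign]

theorem links_ker_iff (hf : ∀ i, f (b i) ≠ 0) :
    Links (sphereAtInfinity ![ℝ ∙ ∑ i, b i, LinearMap.ker f])
        (sphereAtInfinity fun i => ℝ ∙ b i) ↔ HasConstantSign (f ∘ b) := by
  obtain ⟨g, l, φ, hl, habs, hsign, hA, hB⟩ := exists_adapted_translate hf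
  rw [hA, hB, links_image_iff, links_orthHyperplane_iff hl habs, hsign]

end AdaptedTranslates

section ProjectiveSimplices

variable {m : ℕ} {Ls : Fin m → ℙ ℝ (Fin m → ℝ)} {b : Module.Basis (Fin m) ℝ (Fin m → ℝ)}
  {v : Fin m → ℝ} {x : ℙ ℝ (Fin m → ℝ)}

theorem mk_mem_projPoints_iff {W : Submodule ℝ (Fin m → ℝ)} (hv : v ≠ 0) :
    Projectivization.mk ℝ v hv ∈ projPoints W ↔ v ∈ W := by
  rw [projPoints, Set.mem_ofPred_eq, Projectivization.submodule_mk,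
    Submodule.span_singleton_le_iff_mem]

theorem faceHyperplane_eq_ker (hb : ∀ i, (Ls i).submodule = ℝ ∙ b i) (i : Fin m) :
    faceHyperplane Ls i = LinearMap.ker (b.coord i) := by
  refine le_antisymm (iSup₂_le fun j hj => ?_) fun v hv => ?_
  · rw [hb, Submodule.span_singleton_le_iff_mem, LinearMap.mem_ker, Module.Basis.coord_apply,
      Module.Basis.repr_self, Finsupp.single_eq_of_ne hj.symm]
  · rw [← b.sum_repr v]
    refine Submodule.sum_mem _ fun j _ => ?_
    rcases eq_or_ne j i with rfl | hj
    · rw [show b.repr v j = 0 from hv, zero_smul]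
      exact Submodule.zero_mem _
    · have hle : (Ls j).submodule ≤ faceHyperplane Ls i := le_iSup₂_of_le j hj le_rfl
      exact Submodule.smul_mem _ _ (hle (hb j ▸ Submodule.mem_span_singleton_self _))

theorem mem_faceComplement_iff :
    x ∈ faceComplement Ls ↔ ∀ i, x ∉ projPoints (faceHyperplane Ls i) := by
  simp only [faceComplement, Set.mem_compl_iff, Set.mem_iUnion, not_exists]

theorem mk_mem_faceComplement_iff (hb : ∀ i, (Ls i).submodule = ℝ ∙ b i) (hv : v ≠ 0) :
    Projectivization.mk ℝ v hv ∈ faceComplement Ls ↔ ∀ i, b.repr v i ≠ 0 := by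
  simp only [mem_faceComplement_iff, mk_mem_projPoints_iff, faceHyperplane_eq_ker hb,
    LinearMap.mem_ker, Module.Basis.coord_apply, ne_eq]

theorem exists_basis_of_independent (h : Projectivization.Independent Ls) :
    ∃ b : Module.Basis (Fin m) ℝ (Fin m → ℝ), ∀ i, (Ls i).submodule = ℝ ∙ b i := by
  classical
  refine ⟨basisOfPiSpaceOfLinearIndependent (Projectivization.independent_iff.mp h), fun i => ?_⟩
  rw [coe_basisOfPiSpaceOfLinearIndependent, Projectivization.submodule_eq, Function.comp_apply]

theorem exists_basis_of_mem_faceComplement (h : Projectivization.Independent Ls)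
    (hx : x ∈ faceComplement Ls) : ∃ b : Module.Basis (Fin m) ℝ (Fin m → ℝ),
      (∀ i, (Ls i).submodule = ℝ ∙ b i) ∧ x.submodule = ℝ ∙ ∑ i, b i := by
  obtain ⟨b, hb⟩ := exists_basis_of_independent h
  induction x using Projectivization.ind with
  | h v hv =>
    have hunit : ∀ i, IsUnit (b.repr v i) := fun i =>
      ((mk_mem_faceComplement_iff hb hv).mp hx i).isUnit
    refine ⟨b.isUnitSMul hunit, fun i => ?_, ?_⟩
    · rw [Module.Basis.isUnitSMul_apply, Submodule.span_singleton_smul_eq (hunit i), hb]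
    · simp only [Module.Basis.isUnitSMul_apply, b.sum_repr, Projectivization.submodule_mk]

theorem exists_ker_eq_of_finrank_add_one {P : Submodule ℝ (Fin m → ℝ)}
    (hP : Module.finrank ℝ P + 1 = m) : ∃ f : (Fin m → ℝ) →ₗ[ℝ] ℝ, LinearMap.ker f = P := by
  have hlt : P < ⊤ := lt_top_iff_ne_top.mpr fun h => by
    rw [h, finrank_top, Module.finrank_fin_fun] at hP
    omega
  obtain ⟨f, hf_ne, hle⟩ := P.exists_le_ker_of_lt_top hlt
  refine ⟨f, (Submodule.eq_of_le_of_finrank_eq hle ?_).symm⟩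
  have hker := Module.Dual.finrank_ker_add_one_of_ne_zero hf_ne
  rw [Module.finrank_fin_fun] at hker
  omega

theorem GeneralPosition.exists_basis_ker {L : ℙ ℝ (Fin m → ℝ)} {P : Submodule ℝ (Fin m → ℝ)}
    (hgen : GeneralPosition Ls L P) (hP : Module.finrank ℝ P + 1 = m) :
    ∃ (b : Module.Basis (Fin m) ℝ (Fin m → ℝ)) (f : (Fin m → ℝ) →ₗ[ℝ] ℝ),
      (∀ i, (Ls i).submodule = ℝ ∙ b i) ∧ L.submodule = ℝ ∙ ∑ i, b i ∧ LinearMap.ker f = P ∧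
        ∀ i, f (b i) ≠ 0 := by
  obtain ⟨b, hb, hL⟩ := exists_basis_of_mem_faceComplement hgen.independent
    (mem_faceComplement_iff.mpr hgen.notMem_face)
  obtain ⟨f, rfl⟩ := exists_ker_eq_of_finrank_add_one hP
  refine ⟨b, f, hb, hL, rfl, fun i hi => hgen.vertex_notMem i ?_⟩
  rw [projPoints, Set.mem_ofPred_eq, hb, Submodule.span_singleton_le_iff_mem]
  exact hi

/-- The open projective simplex spanned by the vectors `w i`. -/
def openSimplex (w : Fin m → Fin m → ℝ) : Set (ℙ ℝ (Fin m → ℝ)) :=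
  {x | ∃ c : Fin m → ℝ, (∀ i, 0 < c i) ∧ ∑ i, c i • w i ∈ x.submodule}

theorem continuous_repr (b : Module.Basis (Fin m) ℝ (Fin m → ℝ)) (i : Fin m) :
    Continuous fun v : {v : Fin m → ℝ // v ≠ 0} => b.repr v.1 i :=
  (LinearMap.continuous_of_finiteDimensional (b.coord i)).comp continuous_subtype_val

theorem isOpen_iff_preimage_mk' {s : Set (ℙ ℝ (Fin m → ℝ))} :
    IsOpen s ↔ IsOpen (Projectivization.mk' ℝ ⁻¹' s) :=
  isOpen_coinduced

theorem mem_openSimplex_of_eq_span_sum {w : Fin m → Fin m → ℝ}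
    (hx : x.submodule = ℝ ∙ ∑ i, w i) : x ∈ openSimplex w :=
  ⟨1, fun _ => zero_lt_one, by
    simp only [Pi.one_apply, one_smul, hx, Submodule.mem_span_singleton_self]⟩

variable [NeZero m]

theorem sum_smul_basis_ne_zero_of_pos {c : Fin m → ℝ} (hc : ∀ i, 0 < c i) :
    ∑ i, c i • b i ≠ 0 := fun h =>
  (hc 0).ne' (Fintype.linearIndependent_iff.mp b.linearIndependent c h 0)

theorem mk_mem_openSimplex_iff (hv : v ≠ 0) :
    Projectivization.mk ℝ v hv ∈ openSimplex b ↔ HasConstantSign (b.repr v) := by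
  rw [openSimplex, Set.mem_ofPred_eq, Projectivization.submodule_mk]
  constructor
  · rintro ⟨c, hc, h⟩
    obtain ⟨a, ha⟩ := Submodule.mem_span_singleton.mp h
    have hrepr : a • ⇑(b.repr v) = c := by
      rw [← Finsupp.coe_smul, ← map_smul, ha]
      exact b.repr_sum_self c
    have ha_ne : a ≠ 0 := fun h0 => (hc 0).ne' (by rw [← hrepr, h0, zero_smul, Pi.zero_apply])
    exact (hasConstantSign_smul_iff ha_ne).mp (hrepr ▸ Or.inl hc)
  · rintro (h | h)
    · exact ⟨b.repr v, h, by rw [b.sum_repr]; exact Submodule.mem_span_singleton_self _⟩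
    · refine ⟨fun i => -b.repr v i, fun i => neg_pos.mpr (h i), ?_⟩
      simp only [neg_smul, Finset.sum_neg_distrib, b.sum_repr]
      exact Submodule.neg_mem _ (Submodule.mem_span_singleton_self _)

theorem isOpen_openSimplex (b : Module.Basis (Fin m) ℝ (Fin m → ℝ)) : IsOpen (openSimplex b) := by
  have hpre : Projectivization.mk' ℝ ⁻¹' openSimplex b =
      (⋂ i, {v : {v : Fin m → ℝ // v ≠ 0} | 0 < b.repr v.1 i}) ∪ ⋂ i, {v | b.repr v.1 i < 0} := by
    ext v
    simp only [Set.mem_preimage, Projectivization.mk'_eq_mk, mk_mem_openSimplex_iff,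
      HasConstantSign, Set.mem_union, Set.mem_iInter, Set.mem_ofPred_eq]
  rw [isOpen_iff_preimage_mk', hpre]
  exact (isOpen_iInter_of_finite fun i => isOpen_lt continuous_const (continuous_repr b i)).union
    (isOpen_iInter_of_finite fun i => isOpen_lt (continuous_repr b i) continuous_const)

theorem isOpen_faceComplement_diff_openSimplex (hb : ∀ i, (Ls i).submodule = ℝ ∙ b i) :
    IsOpen (faceComplement Ls \ openSimplex b) := by
  have hpre : Projectivization.mk' ℝ ⁻¹' (faceComplement Ls \ openSimplex b) =
      (⋂ i, {v : {v : Fin m → ℝ // v ≠ 0} | b.repr v.1 i ≠ 0}) ∩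
        ((⋃ i, {v | b.repr v.1 i < 0}) ∩ ⋃ i, {v | 0 < b.repr v.1 i}) := by
    ext v
    simp only [Set.preimage_sdiff, Set.mem_sdiff, Set.mem_preimage, Projectivization.mk'_eq_mk,
      mk_mem_openSimplex_iff, mk_mem_faceComplement_iff hb, HasConstantSign, Set.mem_inter_iff,
      Set.mem_iInter, Set.mem_iUnion, Set.mem_ofPred_eq, not_or, not_forall, not_lt]
    exact and_congr_right fun h => and_congr (exists_congr fun i => (h i).le_iff_lt)
      (exists_congr fun i => (h i).symm.le_iff_lt)
  rw [isOpen_iff_preimage_mk', hpre]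
  exact (isOpen_iInter_of_finite fun i => isOpen_ne_fun (continuous_repr b i)
    continuous_const).inter
    ((isOpen_iUnion fun i => isOpen_lt (continuous_repr b i) continuous_const).inter
      (isOpen_iUnion fun i => isOpen_lt continuous_const (continuous_repr b i)))

theorem openSimplex_subset_faceComplement (hb : ∀ i, (Ls i).submodule = ℝ ∙ b i) :
    openSimplex b ⊆ faceComplement Ls := by
  intro x
  induction x using Projectivization.ind with
  | h v hv =>
    rw [mk_mem_openSimplex_iff, mk_mem_faceComplement_iff hb]
    rintro (h | h)
    · exact fun i => (h i).ne'
    · exact fun i => (h i).ne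

theorem openSimplex_eq_image (b : Module.Basis (Fin m) ℝ (Fin m → ℝ)) :
    openSimplex b = Projectivization.mk' ℝ '' {v | ∀ i, 0 < b.repr v.1 i} := by
  ext x
  constructor
  · rintro ⟨c, hc, hx⟩
    have hne := sum_smul_basis_ne_zero_of_pos (b := b) hc
    refine ⟨⟨_, hne⟩, fun i => (hc i).trans_eq (congrFun (b.repr_sum_self c) i).symm, ?_⟩
    induction x using Projectivization.ind with
    | h v hv =>
      rw [Projectivization.submodule_mk, Submodule.mem_span_singleton] at hx
      exact (Projectivization.mk_eq_mk_iff' ℝ _ _ hne hv).mpr hx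
  · rintro ⟨v, hv, rfl⟩
    exact (mk_mem_openSimplex_iff v.2).mpr (Or.inl hv)

theorem isPreconnected_openSimplex (b : Module.Basis (Fin m) ℝ (Fin m → ℝ)) :
    IsPreconnected (openSimplex b) := by
  have hconvex : Convex ℝ {v | ∀ i, 0 < b.repr v i} := by
    rw [Set.ofPred_forall]
    exact convex_iInter fun i => convex_halfSpace_gt (b.coord i).isLinear 0
  have himage : ((↑) : {v : Fin m → ℝ // v ≠ 0} → Fin m → ℝ) '' {v | ∀ i, 0 < b.repr v.1 i} =
      {v | ∀ i, 0 < b.repr v i} := by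
    refine Set.Subset.antisymm (Set.image_subset_iff.mpr fun v hv => hv) fun v hv => ?_
    exact ⟨⟨v, fun h0 => (hv 0).ne' (by rw [h0, map_zero b.repr, Finsupp.zero_apply])⟩, hv, rfl⟩
  rw [openSimplex_eq_image]
  refine IsPreconnected.image ?_ _ continuous_coinduced_rng.continuousOn
  exact Topology.IsInducing.subtypeVal.isPreconnected_image.mp
    (himage ▸ hconvex.isPreconnected)

theorem connectedComponentIn_faceComplement_eq_openSimplex
    (hb : ∀ i, (Ls i).submodule = ℝ ∙ b i) (hx : x ∈ openSimplex b) :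
    connectedComponentIn (faceComplement Ls) x = openSimplex b := by
  have hsub := openSimplex_subset_faceComplement hb
  refine Set.Subset.antisymm ?_
    ((isPreconnected_openSimplex b).subset_connectedComponentIn hx hsub)
  refine isPreconnected_connectedComponentIn.subset_left_of_subset_union (isOpen_openSimplex b)
    (isOpen_faceComplement_diff_openSimplex hb) Set.disjoint_sdiff_right ?_
    ⟨x, mem_connectedComponentIn (hsub hx), hx⟩
  rw [Set.union_sdiff_cancel hsub]
  exact connectedComponentIn_subset _ _

theorem disjoint_openSimplex_projPoints_ker_iff {f : (Fin m → ℝ) →ₗ[ℝ] ℝ}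
    (hf : ∀ i, f (b i) ≠ 0) :
    Disjoint (openSimplex b) (projPoints (LinearMap.ker f)) ↔ HasConstantSign (f ∘ b) := by
  have hfsum : ∀ c : Fin m → ℝ, f (∑ i, c i • b i) = c ⬝ᵥ (f ∘ b) := fun c => by
    simp only [map_sum, map_smul, smul_eq_mul, dotProduct, Function.comp_apply]
  rw [← forall_pos_dotProduct_ne_zero_iff (a := f ∘ b) hf, Set.disjoint_left]
  constructor
  · intro h c hc h0
    have hne := sum_smul_basis_ne_zero_of_pos (b := b) hc
    refine h (a := Projectivization.mk ℝ _ hne) ⟨c, hc, ?_⟩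
      ((mk_mem_projPoints_iff hne).mpr ((hfsum c).trans h0))
    rw [Projectivization.submodule_mk]
    exact Submodule.mem_span_singleton_self _
  · rintro h x ⟨c, hc, hx⟩ hker
    exact h c hc ((hfsum c).symm.trans (hker hx))

theorem isOpenSimplex_connectedComponentIn (h : Projectivization.Independent Ls)
    (hx : x ∈ faceComplement Ls) :
    IsOpenSimplex Ls (connectedComponentIn (faceComplement Ls) x) := by
  obtain ⟨b, hb, hxb⟩ := exists_basis_of_mem_faceComplement h hx
  refine ⟨b, b.linearIndependent, fun i => hb i ▸ Submodule.mem_span_singleton_self _, ?_⟩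
  exact connectedComponentIn_faceComplement_eq_openSimplex hb (mem_openSimplex_of_eq_span_sum hxb)

end ProjectiveSimplices

end SLSymm

end

theorem mainTheorem4 (m : ℕ) (hm : 2 ≤ m)
    (Ls : Fin m → ℙ ℝ (Fin m → ℝ)) (L : ℙ ℝ (Fin m → ℝ)) (P : Submodule ℝ (Fin m → ℝ))
    (hP : Module.finrank ℝ P + 1 = m)
    (hgen : SLSymm.GeneralPosition Ls L P) :
    (∀ x ∈ SLSymm.faceComplement Ls,
      SLSymm.IsOpenSimplex Ls (connectedComponentIn (SLSymm.faceComplement Ls) x)) ∧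
    Disjoint (SLSymm.sphereAtInfinity fun i => (Ls i).submodule)
      (SLSymm.sphereAtInfinity ![L.submodule, P]) ∧
    (SLSymm.Links (SLSymm.sphereAtInfinity fun i => (Ls i).submodule)
        (SLSymm.sphereAtInfinity ![L.submodule, P]) ↔
      Disjoint (connectedComponentIn (SLSymm.faceComplement Ls) L) (SLSymm.projPoints P)) ∧
    (SLSymm.Links (SLSymm.sphereAtInfinity ![L.submodule, P])
        (SLSymm.sphereAtInfinity fun i => (Ls i).submodule) ↔
      Disjoint (connectedComponentIn (SLSymm.faceComplement Ls) L) (SLSymm.projPoints P)) := by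
  have : NeZero m := ⟨by omega⟩
  refine ⟨fun x => SLSymm.isOpenSimplex_connectedComponentIn hgen.independent, ?_⟩
  obtain ⟨b, f, hb, hL, rfl, hf⟩ := hgen.exists_basis_ker hP
  have hcomponent := SLSymm.connectedComponentIn_faceComplement_eq_openSimplex hb
    (SLSymm.mem_openSimplex_of_eq_span_sum hL)
  simp only [hb, hL, hcomponent, SLSymm.disjoint_openSimplex_projPoints_ker_iff hf]
  exact ⟨SLSymm.disjoint_sphereAtInfinity_basis hf, SLSymm.links_basis_iff hf,
    SLSymm.links_ker_iff hf⟩
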